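/- Let $\mathbb K$ be a field, $n\ge 2$, let $\mathbf a=(a_1,\dots,a_n)$ be a vector of integers $a_i\ge 2$, and let $\mathbf q=(q_{ij})$ be an $n\times n$ matrix over $\mathbb K$ with $q_{ii}=1$ and $q_{ij}q_{ji}=1$ for all $i,j$. Let $$A=A(\mathbf q,\mathbf a)=\mathbb K\langle x_1,\dots,x_n\rangle/\langle x_i^{a_i},\ x_jx_i-q_{ij}x_ix_j\ (1\le i,j\le n)\rangle$$ be the quantum complete intersection. For $\mathbf v\in\mathbb N_0^n$ put $x_{\mathbf v}=x_1^{v_1}\cdots x_n^{v_n}$. Let $V=\{\mathbf v\in\mathbb N_0^n: v_i\le a_i-1 \text{ for all } i\}$, $\mathbf 1=(1,\dots,1)$, so that $\{x_{\mathbf v}\}_{\mathbf v\in V}$ is a basis of $A$, with dual basis $\{x_{\mathbf v}^*\}$. Let $\mathbf e_i$ be the unit vectors. For $\mathbf u,\mathbf v\in\mathbb Z^n$ put $$\mathbf q^{\langle\mathbf u|\mathbf v\rangle}=\prod_{1\le i<j\le n}q_{ij}^{u_jv_i},\qquad h_{\mathbf v}=\frac{\mathbf q^{\langle\mathbf a-\mathbf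 1-\mathbf v|\mathbf v\rangle}}{\mathbf q^{\langle\mathbf v|\mathbf a-\mathbf 1-\mathbf v\rangle}}.$$ A permutation $\pi\in S_n$ acts on vectors by $\pi(\mathbf v)=(v_{\pi^{-1}(1)},\dots,v_{\pi^{-1}(n)})$; it is called compatible if $a_{\pi(i)}=a_i$ and $q_{\pi(i)\pi(j)}=q_{ji}$ for all $i,j$. Put $q_\pi=\prod_{1\le j<k\le n}(\mathbf q^{\langle\pi(\mathbf e_k)|\pi(\mathbf e_j)\rangle})^{(a_k-1)(a_j-1)}$. A bi-Frobenius algebra $(B,\phi,t,S)$ consists of a finite-dimensional $\mathbb K$-algebra $B$ which is also a coalgebra $(B,\Delta,\varepsilon)$, together with $t\in B$, $\phi\in B^*$ and the linear map $S(b)=\sum\phi(t_1b)t_2$, such that: (i) $\varepsilon$ is an algebra homomorphism and $\Delta(1)=1\otimes1$; (ii) every element of $B^*$ has the form $x\mapsto\phi(xb)$ with $b\in B$, and every element of $B$ has the form $\sum f(t_1)t_2$ with $f\in B^*$; (iii) $S$, the antipode, is an algebra anti-homomorphism and a coalgebra anti-homomorphism. If $B=A(\mathbf q,\mathbf a)$,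 then $S$ is called a permutation antipode if there are a permutation $\sigma$ of $V$ and scalars $c_{\mathbf v}\in\mathbb K$ with $S(x_{\mathbf v})=c_{\mathbf v}x_{\sigma(\mathbf v)}$ for all $\mathbf v\in V$. **Theorem.** The algebra $A=A(\mathbf q,\mathbf a)$ admits a bi-Frobenius algebra structure $(A,\phi,t,S)$ (for some coalgebra structure on $A$ and some $\phi$, $t$) with permutation antipode if and only if there are a compatible permutation $\pi\in S_n$ with $\pi^2=\mathrm{Id}$ and scalars $c_1,\dots,c_n\in\mathbb K$ such that $$c_ic_{\pi(i)}=h_{\mathbf e_i}\quad(1\le i\le n),\qquad q_\pi\prod_{1\le i\le n}c_i^{a_i-1}=1.$$ If this is the case, then for any such $\pi$ and $c_1,\dots,c_n$ the quadruple $(A,x_{\mathbf a-\mathbf 1}^*,x_{\mathbf a-\mathbf 1},S)$ is a bi-Frobenius algebra, where the coalgebra structure is given by $\varepsilon(x_{\mathbf v})=\delta_{\mathbf v,\mathbf 0}$ for $\mathbf v\in V$, $\Delta(1)=1\otimes1$, $\Delta(x_{\mathbf v})=1\otimes x_{\mathbf v}+x_{\mathbf v}\otimes1$ for $\mathbf v\in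 V\setminus\{\mathbf 0,\mathbf a-\mathbf 1\}$, and $$\Delta(x_{\mathbf a-\mathbf 1})=\sum_{\mathbf v\in V}g_{\mathbf a-\mathbf 1-\mathbf v,\pi(\mathbf v)}\,x_{\mathbf a-\mathbf 1-\mathbf v}\otimes x_{\pi(\mathbf v)},$$ $$g_{\mathbf a-\mathbf 1-\mathbf v,\pi(\mathbf v)}=\frac1{\mathbf q^{\langle\mathbf a-\mathbf 1-\mathbf v|\mathbf v\rangle}}\prod_{1\le i\le n}c_i^{v_i}\prod_{1\le j<k\le n}(\mathbf q^{\langle\pi(\mathbf e_k)|\pi(\mathbf e_j)\rangle})^{v_jv_k},$$ and where $$S(x_{\mathbf v})=\prod_{1\le i\le n}c_i^{v_i}\prod_{1\le j<k\le n}(\mathbf q^{\langle\pi(\mathbf e_k)|\pi(\mathbf e_j)\rangle})^{v_jv_k}\,x_{\pi(\mathbf v)}\qquad(\mathbf v\in V).$$ In particular $S(x_i)=c_ix_{\pi(i)}$ for $1\le i\le n$. -/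

import Mathlib

open scoped TensorProduct

/-! ### Bi-Frobenius algebras -/

section BiFrobenius

universe u v

/-- `(A, φ)` is a Frobenius algebra, where `A` is finite-dimensional: `A^* = A ⇀ φ`,
with `(a ⇀ φ)(x) = φ(x a)`. -/
def IsFrobeniusAlgebraPair (K : Type u) {A : Type v} [Field K] [Ring A] [Algebra K A]
    (φ : Module.Dual K A) : Prop :=
  ∀ f : Module.Dual K A, ∃ a : A, ∀ x : A, f x = φ (x * a)

/-- The right action `t ↼ f = ∑ f(t₁) t₂` of the dual of a coalgebra on the coalgebra. -/
noncomputable def coalgRightAct (K : Type u) {A : Type v} [Field K] [AddCommGroup A] [Module K A]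
    [Coalgebra K A] (t : A) (f : Module.Dual K A) : A :=
  TensorProduct.lid K A (f.rTensor A (Coalgebra.comul (R := K) t))

/-- `(A, t)` is a Frobenius coalgebra, where `A` is finite-dimensional: `A = t ↼ A^*`. -/
def IsFrobeniusCoalgebraPair (K : Type u) {A : Type v} [Field K] [AddCommGroup A] [Module K A]
    [Coalgebra K A] (t : A) : Prop :=
  ∀ x : A, ∃ f : Module.Dual K A, coalgRightAct K t f = x

/-- `(A, φ, t, S)` is a bi-Frobenius algebra; the coalgebra structure on the algebra `A` is the
instance argument, and no compatibility between it and the multiplication is presupposed. -/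
structure IsBiFrobenius (K : Type u) {A : Type v} [Field K] [Ring A] [Algebra K A]
    [Coalgebra K A] (φ : Module.Dual K A) (t : A) (S : A →ₗ[K] A) : Prop where
  finite : Module.Finite K A
  /-- `S(a) = ∑ φ(t₁ a) t₂`, that is, `S(a) = t ↼ (a ⇀ φ)` -/
  antipode_eq : ∀ a : A, S a = coalgRightAct K t (φ ∘ₗ LinearMap.mulRight K a)
  counit_one : Coalgebra.counit (R := K) (1 : A) = 1
  counit_mul : ∀ a b : A, Coalgebra.counit (R := K) (a * b) =
    Coalgebra.counit (R := K) a * Coalgebra.counit (R := K) b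
  comul_one : Coalgebra.comul (R := K) (1 : A) = 1 ⊗ₜ[K] 1
  frobenius_algebra : IsFrobeniusAlgebraPair K φ
  frobenius_coalgebra : IsFrobeniusCoalgebraPair K t
  antipode_one : S 1 = 1
  antipode_mul : ∀ a b : A, S (a * b) = S b * S a
  counit_antipode : ∀ a : A, Coalgebra.counit (R := K) (S a) = Coalgebra.counit (R := K) a
  /-- `Δ(S(a)) = ∑ S(a₂) ⊗ S(a₁)` -/
  comul_antipode : ∀ a : A, Coalgebra.comul (R := K) (S a) =
    TensorProduct.comm K A A (TensorProduct.map S S (Coalgebra.comul (R := K) a))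

end BiFrobenius

/-! ### Quantum complete intersections -/

/-- The parameters `(q, a)` of a quantum complete intersection in `n ≥ 2` variables. -/
structure QCIParam (K : Type*) [Field K] (n : ℕ) where
  q : Matrix (Fin n) (Fin n) K
  a : Fin n → ℕ
  two_le_n : 2 ≤ n
  two_le_a : ∀ i, 2 ≤ a i
  q_diag : ∀ i, q i i = 1
  q_mul : ∀ i j, q i j * q j i = 1

namespace QCIParam

variable {K : Type*} [Field K] {n : ℕ} (P : QCIParam K n)

/-- The defining relations `x_i^{a_i} = 0` and `x_j x_i = q_{ij} x_i x_j`. -/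
inductive Rel : FreeAlgebra K (Fin n) → FreeAlgebra K (Fin n) → Prop
  | pow (i : Fin n) : Rel (FreeAlgebra.ι K i ^ P.a i) 0
  | comm (i j : Fin n) : Rel (FreeAlgebra.ι K j * FreeAlgebra.ι K i)
      (P.q i j • (FreeAlgebra.ι K i * FreeAlgebra.ι K j))

/-- The quantum complete intersection `A(q, a)`. -/
abbrev Alg : Type _ := RingQuot P.Rel

/-- The generator `x_i`. -/
noncomputable def x (i : Fin n) : P.Alg := RingQuot.mkAlgHom K P.Rel (FreeAlgebra.ι K i)

/-- The monomial `x_v = x_1^{v_1} ⋯ x_n^{v_n}` for `v ∈ ℕ^n`. -/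
noncomputable def mon (v : Fin n → ℕ) : P.Alg :=
  ((List.finRange n).map fun i => P.x i ^ v i).prod

/-- The index set `V = {v ∈ ℕ^n | v_i ≤ a_i - 1}` of the standard basis. -/
abbrev V : Type := (i : Fin n) → Fin (P.a i)

/-- The inclusion of `V` in `ℕ^n`. -/
def toNat (v : P.V) : Fin n → ℕ := fun i => (v i : ℕ)

/-- The zero vector as an element of `V`. -/
def zeroV : P.V := fun i => ⟨0, by have := P.two_le_a i; omega⟩

/-- The vector `a - 1` as an element of `V`. -/
def topV : P.V := fun i => ⟨P.a i - 1, by have := P.two_le_a i; omega⟩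

/-! #### The standard basis -/

theorem q_ne (i j : Fin n) : P.q i j ≠ 0 := left_ne_zero_of_mul_eq_one (P.q_mul i j)

theorem x_pow (i : Fin n) : P.x i ^ P.a i = 0 := by
  have := RingQuot.mkAlgHom_rel K (Rel.pow (P := P) i)
  simpa [x] using this

theorem x_comm (i j : Fin n) : P.x j * P.x i = P.q i j • (P.x i * P.x j) := by
  have := RingQuot.mkAlgHom_rel K (Rel.comm (P := P) i j)
  simpa [x] using this

theorem x_mul_pow (i j : Fin n) (k : ℕ) :
    P.x i * P.x j ^ k = P.q j i ^ k • (P.x j ^ k * P.x i) := by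
  induction k with
  | zero => simp
  | succ k ih =>
    rw [pow_succ, ← mul_assoc, ih, smul_mul_assoc, mul_assoc, P.x_comm j i, mul_smul_comm,
      smul_smul, pow_succ, mul_assoc]

theorem x_mul_list (i : Fin n) (v : Fin n → ℕ) (l : List (Fin n)) (hl : l.Nodup) (hi : i ∈ l) :
    ∃ c : K, P.x i * (l.map fun j => P.x j ^ v j).prod =
      c • (l.map fun j => P.x j ^ (v + Pi.single i 1 : Fin n → ℕ) j).prod := by
  induction l with
  | nil => simp at hi
  | cons j l ih =>
    rw [List.nodup_cons] at hl
    by_cases hij : j = i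
    · subst hij
      refine ⟨1, ?_⟩
      have : (l.map fun k => P.x k ^ (v + Pi.single j 1 : Fin n → ℕ) k) = l.map fun k => P.x k ^ v k := by
        refine List.map_congr_left fun k hk => ?_
        have hkj : k ≠ j := fun h => hl.1 (h ▸ hk)
        simp [Pi.single_eq_of_ne hkj]
      simp only [List.map_cons, List.prod_cons, this, one_smul]
      rw [← mul_assoc, ← pow_succ']
      simp
    · have hi' : i ∈ l := by
        rcases List.mem_cons.1 hi with h | h
        · exact absurd h.symm hij
        · exact h
      obtain ⟨c, hc⟩ := ih hl.2 hi'
      refine ⟨P.q j i ^ v j * c, ?_⟩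
      simp only [List.map_cons, List.prod_cons]
      rw [← mul_assoc, P.x_mul_pow, smul_mul_assoc, mul_assoc, hc, mul_smul_comm, smul_smul]
      simp [Pi.single_eq_of_ne hij]

theorem mon_eq_zero (v : Fin n → ℕ) (i : Fin n) (h : P.a i ≤ v i) : P.mon v = 0 := by
  refine List.prod_eq_zero (List.mem_map.2 ⟨i, List.mem_finRange i, ?_⟩)
  rw [← Nat.sub_add_cancel h, pow_add, P.x_pow, mul_zero]

theorem mon_mem (v : Fin n → ℕ) :
    P.mon v ∈ Submodule.span K (Set.range fun w : P.V => P.mon (P.toNat w)) := by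
  by_cases h : ∀ i, v i < P.a i
  · exact Submodule.subset_span ⟨fun i => ⟨v i, h i⟩, rfl⟩
  · push Not at h
    obtain ⟨i, hi⟩ := h
    rw [P.mon_eq_zero v i hi]
    exact Submodule.zero_mem _

theorem mon_span : ⊤ ≤ Submodule.span K (Set.range fun w : P.V => P.mon (P.toNat w)) := by
  set W := Submodule.span K (Set.range fun w : P.V => P.mon (P.toNat w)) with hW
  have key : ∀ y : FreeAlgebra K (Fin n), ∀ s ∈ W, RingQuot.mkAlgHom K P.Rel y * s ∈ W := by
    intro y
    induction y using FreeAlgebra.induction with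
    | grade0 r =>
      intro s hs
      rw [AlgHom.commutes, ← Algebra.smul_def]
      exact W.smul_mem r hs
    | grade1 i =>
      intro s hs
      induction hs using Submodule.span_induction with
      | mem s h =>
        obtain ⟨w, rfl⟩ := h
        obtain ⟨c, hc⟩ := P.x_mul_list i (P.toNat w) _ (List.nodup_finRange n)
          (List.mem_finRange i)
        change P.x i * P.mon _ ∈ W
        rw [mon, hc]
        exact W.smul_mem c (P.mon_mem _)
      | zero => simp
      | add s t _ _ h1 h2 => rw [mul_add]; exact W.add_mem h1 h2
      | smul c s _ h => rw [mul_smul_comm]; exact W.smul_mem c h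
    | mul y z hy hz =>
      intro s hs
      rw [map_mul, mul_assoc]
      exact hy _ (hz _ hs)
    | add y z hy hz =>
      intro s hs
      rw [map_add, add_mul]
      exact W.add_mem (hy _ hs) (hz _ hs)
  intro y _
  obtain ⟨y, rfl⟩ := RingQuot.mkAlgHom_surjective K P.Rel y
  have h1 : (1 : P.Alg) ∈ W := by
    have := P.mon_mem 0
    have h0 : P.mon 0 = 1 := by simp [mon]
    rwa [h0] at this
  simpa using key y 1 h1

/-- The scalar by which left multiplication with `x_i` acts on the monomial of exponent `v`. -/
def opCoeff (i : Fin n) (v : Fin n → ℕ) : K :=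
  if v i + 1 < P.a i then ∏ j, (if j < i then P.q j i ^ v j else 1) else 0

/-- The operator by which `x_i` acts on the free module on all exponents. -/
noncomputable def op (i : Fin n) : Module.End K ((Fin n → ℕ) →₀ K) :=
  Finsupp.linearCombination K fun v => Finsupp.single (v + Pi.single i 1) (P.opCoeff i v)

theorem op_single (i : Fin n) (v : Fin n → ℕ) (c : K) :
    P.op i (Finsupp.single v c) = Finsupp.single (v + Pi.single i 1) (c * P.opCoeff i v) := by
  simp [op, Finsupp.linearCombination_single]

theorem opCoeff_ne (i : Fin n) (v : Fin n → ℕ) (h : v i + 1 < P.a i) : P.opCoeff i v ≠ 0 := by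
  rw [opCoeff, if_pos h, Finset.prod_ne_zero_iff]
  intro j _
  split_ifs
  · exact pow_ne_zero _ (P.q_ne _ _)
  · exact one_ne_zero

theorem op_pow_single (i : Fin n) (v : Fin n → ℕ) (c : K) (k : ℕ) :
    ∃ d : K, (P.op i ^ k) (Finsupp.single v c) = Finsupp.single (v + Pi.single i k) d ∧
      (k ≠ 0 → P.a i ≤ v i + k → d = 0) ∧ (c ≠ 0 → v i + k < P.a i → d ≠ 0) := by
  induction k with
  | zero => exact ⟨c, by simp, by simp, fun h _ => h⟩
  | succ k ih =>
    obtain ⟨d, hd, h0, h1⟩ := ih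
    refine ⟨d * P.opCoeff i (v + Pi.single i k), ?_, ?_, ?_⟩
    · rw [pow_succ', Module.End.mul_apply, hd, op_single, add_assoc, ← Pi.single_add]
    · intro _ h
      rw [opCoeff, if_neg, mul_zero]
      simp
      omega
    · intro hc h
      refine mul_ne_zero (h1 hc (by omega)) (P.opCoeff_ne _ _ ?_)
      simp
      omega

theorem opCoeff_comm (i j : Fin n) (v : Fin n → ℕ) :
    P.opCoeff i v * P.opCoeff j (v + Pi.single i 1) =
      P.q i j * (P.opCoeff j v * P.opCoeff i (v + Pi.single j 1)) := by
  by_cases hij : i = j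
  · subst hij
    rw [P.q_diag, one_mul]
  have hji : j ≠ i := fun h => hij h.symm
  have main : ∀ i j : Fin n, i ≠ j →
      (∏ k, (if k < j then P.q k j ^ (v + Pi.single i 1 : Fin n → ℕ) k else 1)) =
      (if i < j then P.q i j else 1) * ∏ k, (if k < j then P.q k j ^ v k else 1) := by
    intro i j _
    have : (if i < j then P.q i j else 1) =
        ∏ k, (if k = i then (if k < j then P.q k j else 1) else 1) := by
      simp
    rw [this, ← Finset.prod_mul_distrib]
    refine Finset.prod_congr rfl fun k _ => ?_
    by_cases hk : k = i
    · subst hk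
      by_cases hkj : k < j <;> simp [hkj, pow_succ']
    · simp [hk]
  have e1 : (v + Pi.single i 1 : Fin n → ℕ) j = v j := by simp [hji]
  have e2 : (v + Pi.single j 1 : Fin n → ℕ) i = v i := by simp [hij]
  rw [opCoeff, opCoeff, opCoeff, opCoeff, main i j hij, main j i hji, e1, e2]
  generalize (∏ k, if k < i then P.q k i ^ v k else 1) = X
  generalize (∏ k, if k < j then P.q k j ^ v k else 1) = Y
  have hq := P.q_mul i j
  rcases lt_or_gt_of_ne hij with hlt | hlt
  · rw [if_pos hlt, if_neg hlt.asymm]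
    split_ifs <;> ring
  · rw [if_neg hlt.asymm, if_pos hlt]
    split_ifs
    · linear_combination (-X * Y) * hq
    all_goals ring

/-- The action of `A(q, a)` on the free module on all exponents. -/
noncomputable def rep : P.Alg →ₐ[K] Module.End K ((Fin n → ℕ) →₀ K) :=
  RingQuot.liftAlgHom K ⟨FreeAlgebra.lift K P.op, by
    intro y z h
    induction h with
    | pow i =>
      simp only [map_pow, FreeAlgebra.lift_ι_apply, map_zero]
      refine Finsupp.lhom_ext fun v c => ?_
      obtain ⟨d, hd, h0, -⟩ := P.op_pow_single i v c (P.a i)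
      have := P.two_le_a i
      rw [hd, h0 (by omega) (by omega)]
      simp
    | comm i j =>
      simp only [map_mul, map_smul, FreeAlgebra.lift_ι_apply]
      refine Finsupp.lhom_ext fun v c => ?_
      simp only [Module.End.mul_apply, LinearMap.smul_apply, op_single, Finsupp.smul_single]
      rw [add_right_comm]
      congr 1
      rw [mul_assoc, P.opCoeff_comm]
      simp only [smul_eq_mul]
      ring⟩

theorem rep_x (i : Fin n) : P.rep (P.x i) = P.op i := by
  simp [rep, x]

theorem rep_list (v : Fin n → ℕ) (hv : ∀ i, v i < P.a i) (l : List (Fin n)) (hl : l.Nodup) :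
    ∃ c : K, c ≠ 0 ∧ P.rep (l.map fun i => P.x i ^ v i).prod (Finsupp.single 0 1) =
      Finsupp.single (fun i => if i ∈ l then v i else 0) c := by
  induction l with
  | nil => exact ⟨1, one_ne_zero, by simp; rfl⟩
  | cons j l ih =>
    rw [List.nodup_cons] at hl
    obtain ⟨c, hc, h⟩ := ih hl.2
    obtain ⟨d, hd, -, h1⟩ := P.op_pow_single j (fun i => if i ∈ l then v i else 0) c (v j)
    refine ⟨d, h1 hc (by simpa [hl.1] using hv j), ?_⟩
    rw [List.map_cons, List.prod_cons, map_mul, Module.End.mul_apply, h, map_pow, rep_x, hd]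
    congr 1
    funext i
    by_cases hij : i = j
    · subst hij
      simp [hl.1]
    · simp [hij]

theorem rep_mon (v : P.V) : ∃ c : K, c ≠ 0 ∧
    P.rep (P.mon (P.toNat v)) (Finsupp.single 0 1) = Finsupp.single (P.toNat v) c := by
  obtain ⟨c, hc, h⟩ := P.rep_list (P.toNat v) (fun i => (v i).2) _ (List.nodup_finRange n)
  exact ⟨c, hc, by simpa [mon] using h⟩

theorem toNat_injective : Function.Injective P.toNat := by
  intro v w h
  funext i
  exact Fin.ext (congrFun h i)

theorem mon_linearIndependent : LinearIndependent K fun v : P.V => P.mon (P.toNat v) := by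
  choose c hc h using P.rep_mon
  let ev : P.Alg →ₗ[K] ((Fin n → ℕ) →₀ K) :=
    (LinearMap.applyₗ (Finsupp.single 0 1)) ∘ₗ P.rep.toLinearMap
  refine LinearIndependent.of_comp ev ?_
  have h1 : LinearIndependent K fun v : P.V => (Finsupp.single (P.toNat v) (1 : K)) :=
    by simpa [Function.comp_def] using
      (Finsupp.basisSingleOne (R := K) (ι := Fin n → ℕ)).linearIndependent.comp _
        P.toNat_injective
  have h2 := h1.units_smul fun v => Units.mk0 (c v) (hc v)
  convert h2 using 1
  funext v
  simp [ev, h, Units.smul_def]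

/-- The standard basis `{x_v | v ∈ V}` of `A(q, a)`. -/
noncomputable def stdBasis : Module.Basis P.V K P.Alg :=
  Module.Basis.mk P.mon_linearIndependent P.mon_span

theorem stdBasis_apply (v : P.V) : P.stdBasis v = P.mon (P.toNat v) := by
  simp [stdBasis]

/-! #### Structure coefficients -/

/-- `q^{⟨u|v⟩} = ∏_{i<j} q_{ij}^{u_j v_i}` for `u, v ∈ ℤ^n`. -/
def qPair (u v : Fin n → ℤ) : K := ∏ i, ∏ j ∈ Finset.Ioi i, P.q i j ^ (u j * v i)

/-- The vector `a - 1` in `ℤ^n`. -/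
def top : Fin n → ℤ := fun i => (P.a i : ℤ) - 1

/-- `h_v = q^{⟨a-1-v|v⟩} / q^{⟨v|a-1-v⟩}`. -/
def h (v : Fin n → ℤ) : K := P.qPair (P.top - v) v / P.qPair v (P.top - v)

/-- The action `π(v) = (v_{π⁻¹(1)}, …, v_{π⁻¹(n)})` of a permutation on vectors. -/
def act {R : Type*} (π : Equiv.Perm (Fin n)) (v : Fin n → R) : Fin n → R := fun i => v (π⁻¹ i)

/-- The unit vector `e_i` in `ℤ^n`. -/
def e (i : Fin n) : Fin n → ℤ := Pi.single i 1

/-- `∏_{j<k} (q^{⟨π(e_k)|π(e_j)⟩})^{v_j v_k}`. -/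
def permCoeff (π : Equiv.Perm (Fin n)) (v : Fin n → ℕ) : K :=
  ∏ j, ∏ k ∈ Finset.Ioi j, P.qPair (act π (e k)) (act π (e j)) ^ (v j * v k)

/-- `q_π = ∏_{j<k} (q^{⟨π(e_k)|π(e_j)⟩})^{(a_k-1)(a_j-1)}`. -/
def qPerm (π : Equiv.Perm (Fin n)) : K := P.permCoeff π fun i => P.a i - 1

/-- `π` is compatible with `A(q, a)`. -/
def Compatible (π : Equiv.Perm (Fin n)) : Prop :=
  (∀ i, P.a (π i) = P.a i) ∧ ∀ i j, P.q (π i) (π j) = P.q j i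

/-- The conditions on a permutation `π` and scalars `c_1, …, c_n`. -/
structure Admissible (π : Equiv.Perm (Fin n)) (c : Fin n → K) : Prop where
  compatible : P.Compatible π
  sq_eq_one : π ^ 2 = 1
  mul_eq : ∀ i, c i * c (π i) = P.h (e i)
  prod_eq : P.qPerm π * ∏ i, c i ^ (P.a i - 1) = 1

/-! #### Bi-Frobenius structures -/

/-- The linear functional `x_{a-1}^*` of the basis dual to the standard basis. -/
noncomputable def topDual : Module.Dual K P.Alg := P.stdBasis.coord P.topV

/-- The monomial `x_{a-1}`. -/
noncomputable def topMon : P.Alg := P.mon fun i => P.a i - 1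

/-- `S` is, up to scalars, given by a permutation of the standard basis. -/
def IsPermutationMap (S : P.Alg →ₗ[K] P.Alg) : Prop :=
  ∃ (π : Equiv.Perm P.V) (c : P.V → K),
    ∀ v : P.V, S (P.mon (P.toNat v)) = c v • P.mon (P.toNat (π v))

/-- `A(q, a)` admits a bi-Frobenius algebra structure with permutation antipode. -/
def AdmitsPermutationBiFrobenius : Prop :=
  ∃ (_ : Coalgebra K P.Alg) (φ : Module.Dual K P.Alg) (t : P.Alg) (S : P.Alg →ₗ[K] P.Alg),
    IsBiFrobenius K φ t S ∧ P.IsPermutationMap S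

/-- The coefficient `g_{a-1-v, π(v)}`, equal to
`(q^{⟨a-1-v|v⟩})⁻¹ ∏ c_i^{v_i} ∏_{j<k} (q^{⟨π(e_k)|π(e_j)⟩})^{v_j v_k}`. -/
noncomputable def g (π : Equiv.Perm (Fin n)) (c : Fin n → K) (v : P.V) : K :=
  1 / P.qPair (P.top - fun i => (P.toNat v i : ℤ)) (fun i => (P.toNat v i : ℤ)) *
    (∏ i, c i ^ P.toNat v i) * P.permCoeff π (P.toNat v)

/-- The counit with `ε(x_v) = δ_{v,0}` for `v ∈ V`. -/
noncomputable def counitMap : P.Alg →ₗ[K] K :=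
  P.stdBasis.constr K fun v => if v = P.zeroV then 1 else 0

/-- The comultiplication with `Δ(1) = 1 ⊗ 1`,
`Δ(x_{a-1}) = ∑_{v ∈ V} g_{a-1-v, π(v)} x_{a-1-v} ⊗ x_{π(v)}`, and
`Δ(x_v) = 1 ⊗ x_v + x_v ⊗ 1` for the other `v ∈ V`. -/
noncomputable def comulMap (π : Equiv.Perm (Fin n)) (c : Fin n → K) :
    P.Alg →ₗ[K] P.Alg ⊗[K] P.Alg :=
  P.stdBasis.constr K fun v =>
    if v = P.zeroV then 1 ⊗ₜ[K] 1
    else if v = P.topV then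
      ∑ w : P.V, P.g π c w •
        (P.mon (fun i => P.a i - 1 - P.toNat w i) ⊗ₜ[K] P.mon (act π (P.toNat w)))
    else 1 ⊗ₜ[K] P.mon (P.toNat v) + P.mon (P.toNat v) ⊗ₜ[K] 1

/-- The linear map with
`S(x_v) = ∏ c_i^{v_i} ∏_{j<k} (q^{⟨π(e_k)|π(e_j)⟩})^{v_j v_k} x_{π(v)}` for `v ∈ V`. -/
noncomputable def antipodeMap (π : Equiv.Perm (Fin n)) (c : Fin n → K) : P.Alg →ₗ[K] P.Alg :=
  P.stdBasis.constr K fun v =>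
    ((∏ i, c i ^ P.toNat v i) * P.permCoeff π (P.toNat v)) • P.mon (act π (P.toNat v))

end QCIParam

/-! Write `q^⟨u|v⟩` for `qMul u v`. Everything rests on `x_u x_v = q^⟨u|v⟩ x_{u+v}`, valid for all
exponents because a monomial outside the box `V` is zero.

Necessity. The antipode `S` of any bi-Frobenius algebra is bijective. If it also permutes the
standard basis up to scalars, the permutation `σ` is additive where sums stay in `V`, so it cannot
lower the total degree. Since `V` is finite, it preserves the degree. Hence `S(x_i) = c_i x_{π(i)}`
with `π` a permutation, and applying `S` to the defining relations makes `π` compatible. An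
anti-homomorphism is determined on generators, so `S` is the explicit map `antipodeMap`. The other
conditions come from three general facts: `t` is a right integral (`integral_mul`); an eigenvalue of
`S` on `t` must be 1 (`eq_one_of_antipode_integral`); and, once `S(t) = t`, `S²` is the Nakayama
automorphism, `φ(S²(b) x) = φ(x b)` (`apply_antipode_antipode_mul`). In `A(q, a)` the first puts `t`
in the line of `x_{a-1}`, so the second reads `q_π ∏ c_i^{a_i-1} = 1`. The third, tested on
generators, gives `π² = 1` and `c_i c_{π(i)} = h_{e_i}`.

Sufficiency. The coefficients of `S` satisfy the twisted additivity `antipodeCoeff_add`, which makes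
`S` an anti-homomorphism. The comultiplication of `x_{a-1}` is its primitive part plus a sum of
tensors of elements with `Δ(y) = 1 ⊗ y + y ⊗ 1`, and coassociativity holds for each such tensor
separately. The identity `s(v) s(π(v)) = h_v` for the coefficients `s` of `S`
(`antipodeCoeff_mul_act`) turns `v ↦ a - 1 - v` into the symmetry of `Δ(x_{a-1})` that makes `S` a
coalgebra anti-homomorphism. -/

namespace QCIParam

variable {K : Type*} [Field K] {n : ℕ} (P : QCIParam K n)

/-! ### Multiplication of monomials -/

/-- `q_{ij}` for `i < j`, and `1` otherwise. -/
def w (i j : Fin n) : K := if i < j then P.q i j else 1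

/-- `q^{⟨u|v⟩}` for `u, v ∈ ℕ^n`. -/
def qMul (u v : Fin n → ℕ) : K := ∏ i, ∏ j, P.w i j ^ (u j * v i)

theorem w_ne (i j : Fin n) : P.w i j ≠ 0 := by
  unfold w
  split_ifs
  exacts [P.q_ne i j, one_ne_zero]

theorem w_self (i : Fin n) : P.w i i = 1 := by simp [w]

theorem prod_Ioi_eq {M : Type*} [CommMonoid M] (i : Fin n) (f : Fin n → M) :
    ∏ j ∈ Finset.Ioi i, f j = ∏ j, if i < j then f j else 1 := by
  rw [← Finset.prod_filter]
  congr 1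
  ext j
  simp

theorem qPair_cast (u v : Fin n → ℕ) :
    P.qPair (fun i => (u i : ℤ)) (fun i => (v i : ℤ)) = P.qMul u v := by
  refine Finset.prod_congr rfl fun i _ => ?_
  rw [prod_Ioi_eq]
  refine Finset.prod_congr rfl fun j _ => ?_
  unfold w
  split_ifs
  · simp only [← Nat.cast_mul, zpow_natCast]
  · simp

theorem qMul_ne (u v : Fin n → ℕ) : P.qMul u v ≠ 0 :=
  Finset.prod_ne_zero_iff.2 fun _ _ => Finset.prod_ne_zero_iff.2 fun _ _ => pow_ne_zero _ (P.w_ne _ _)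

theorem qMul_add_left (u u' v : Fin n → ℕ) :
    P.qMul (u + u') v = P.qMul u v * P.qMul u' v := by
  simp [qMul, add_mul, pow_add, Finset.prod_mul_distrib]

theorem qMul_add_right (u v v' : Fin n → ℕ) :
    P.qMul u (v + v') = P.qMul u v * P.qMul u v' := by
  simp [qMul, mul_add, pow_add, Finset.prod_mul_distrib]

@[simp] theorem qMul_zero_left (v : Fin n → ℕ) : P.qMul 0 v = 1 := by simp [qMul]

@[simp] theorem qMul_zero_right (v : Fin n → ℕ) : P.qMul v 0 = 1 := by simp [qMul]

theorem qMul_single_single (i j : Fin n) : P.qMul (Pi.single j 1) (Pi.single i 1) = P.w i j := by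
  rw [qMul, Finset.prod_eq_single i, Finset.prod_eq_single j]
  · simp
  · intro k _ hk
    simp [hk]
  · simp
  · intro k _ hk
    simp [hk]
  · simp

theorem pow_mul_pow (i j : Fin n) (k l : ℕ) :
    P.x j ^ k * P.x i ^ l = P.q i j ^ (k * l) • (P.x i ^ l * P.x j ^ k) := by
  induction k with
  | zero => simp
  | succ k ih =>
    rw [pow_succ, mul_assoc, P.x_mul_pow, mul_smul_comm, ← mul_assoc, ih, smul_mul_assoc, smul_smul,
      mul_assoc, ← pow_add]
    congr 2
    ring

theorem list_prod_mul_pow (i : Fin n) (u : Fin n → ℕ) (k : ℕ) (l : List (Fin n)) :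
    (l.map fun j => P.x j ^ u j).prod * P.x i ^ k =
      (l.map fun j => P.q i j ^ (u j * k)).prod •
        (P.x i ^ k * (l.map fun j => P.x j ^ u j).prod) := by
  induction l with
  | nil => simp
  | cons j l ih =>
    simp only [List.map_cons, List.prod_cons]
    rw [mul_assoc, ih, mul_smul_comm, ← mul_assoc, pow_mul_pow, smul_mul_assoc, smul_smul,
      mul_assoc, mul_comm (P.q i j ^ _)]

theorem list_prod_mul (u v : Fin n → ℕ) (l : List (Fin n)) (hl : l.Pairwise (· < ·)) :
    (l.map fun j => P.x j ^ u j).prod * (l.map fun j => P.x j ^ v j).prod =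
      (l.map fun i => (l.map fun j => P.w i j ^ (u j * v i)).prod).prod •
        (l.map fun j => P.x j ^ (u + v) j).prod := by
  induction l with
  | nil => simp
  | cons i l ih =>
    rw [List.pairwise_cons] at hl
    have h1 : (l.map fun j => P.w i j ^ (u j * v i)) = l.map fun j => P.q i j ^ (u j * v i) :=
      List.map_congr_left fun j hj => by rw [w, if_pos (hl.1 j hj)]
    have h2 : (l.map fun k => P.w k i ^ (u i * v k) * (l.map fun j => P.w k j ^ (u j * v k)).prod) =
        l.map fun k => (l.map fun j => P.w k j ^ (u j * v k)).prod :=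
      List.map_congr_left fun k hk => by rw [w, if_neg (hl.1 k hk).asymm, one_pow, one_mul]
    simp only [List.map_cons, List.prod_cons, h1, h2, w_self, one_pow, one_mul]
    rw [mul_assoc, ← mul_assoc _ (P.x i ^ v i), list_prod_mul_pow, smul_mul_assoc, mul_assoc,
      ih hl.2, mul_smul_comm, mul_smul_comm, mul_smul_comm, smul_smul, ← mul_assoc, ← pow_add]
    rfl

theorem mon_mul_mon (u v : Fin n → ℕ) : P.mon u * P.mon v = P.qMul u v • P.mon (u + v) := by
  have := P.list_prod_mul u v (List.finRange n) (List.pairwise_lt_finRange n)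
  simpa only [mon, qMul, Fin.prod_univ_def] using this

@[simp] theorem mon_zero : P.mon 0 = 1 := by simp [mon]

theorem list_prod_single (i : Fin n) (k : ℕ) (l : List (Fin n)) (hl : l.Nodup) :
    (l.map fun j => P.x j ^ (Pi.single i k : Fin n → ℕ) j).prod =
      if i ∈ l then P.x i ^ k else 1 := by
  induction l with
  | nil => simp
  | cons j l ih =>
    rw [List.nodup_cons] at hl
    rw [List.map_cons, List.prod_cons, ih hl.2]
    by_cases hij : i = j
    · subst hij
      simp [hl.1]
    · simp [hij]

theorem mon_single (i : Fin n) (k : ℕ) : P.mon (Pi.single i k) = P.x i ^ k := by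
  rw [mon, P.list_prod_single i k _ (List.nodup_finRange n), if_pos (List.mem_finRange i)]

theorem mon_single_one (i : Fin n) : P.mon (Pi.single i 1) = P.x i := by
  rw [mon_single, pow_one]

/-- The vector `v` as an element of `V`. -/
def ofNat (v : Fin n → ℕ) (hv : ∀ i, v i < P.a i) : P.V := fun i => ⟨v i, hv i⟩

theorem stdBasis_ofNat (v : Fin n → ℕ) (hv : ∀ i, v i < P.a i) :
    P.stdBasis (P.ofNat v hv) = P.mon v := P.stdBasis_apply _

theorem mon_ne_zero_iff (v : Fin n → ℕ) : P.mon v ≠ 0 ↔ ∀ i, v i < P.a i := by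
  constructor
  · intro h i
    by_contra hi
    exact h (P.mon_eq_zero v i (not_lt.1 hi))
  · intro h
    rw [← P.stdBasis_ofNat v h]
    exact P.stdBasis.ne_zero _

/-- Only `u` is assumed to lie in the box: the equation itself then forces `v` into it. -/
theorem eq_of_smul_mon_eq {u v : Fin n → ℕ} {c d : K} (h : c • P.mon u = d • P.mon v)
    (hu : ∀ i, u i < P.a i) (hc : c ≠ 0) : u = v ∧ c = d := by
  have h0 : d • P.mon v ≠ 0 := by
    rw [← h]
    exact smul_ne_zero hc ((P.mon_ne_zero_iff u).2 hu)
  have hv := (P.mon_ne_zero_iff v).1 (right_ne_zero_of_smul h0)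
  rw [← P.stdBasis_ofNat u hu, ← P.stdBasis_ofNat v hv] at h
  have h' := congrArg P.stdBasis.repr h
  simp only [map_smul, Module.Basis.repr_self, Finsupp.smul_single, smul_eq_mul, mul_one] at h'
  rcases (Finsupp.single_eq_single_iff _ _ _ _).1 h' with ⟨h1, h2⟩ | ⟨h1, -⟩
  · exact ⟨congrArg P.toNat h1, h2⟩
  · exact absurd h1 hc

/-! ### Coefficients of permutation antipodes -/

theorem act_single {R : Type*} [Zero R] (π : Equiv.Perm (Fin n)) (i : Fin n) (r : R) :
    act π (Pi.single i r) = Pi.single (π i) r := by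
  funext k
  simp only [act, Pi.single_apply, Equiv.Perm.inv_eq_iff_eq]

theorem act_act {R : Type*} {π : Equiv.Perm (Fin n)} (hπ : π ^ 2 = 1) (v : Fin n → R) :
    act π (act π v) = v := by
  funext k
  have h : π * π = 1 := by rw [← sq, hπ]
  have h' : π⁻¹ = π := inv_eq_of_mul_eq_one_left h
  rw [act, act, h', ← Equiv.Perm.mul_apply, h, Equiv.Perm.one_apply]

theorem act_add (π : Equiv.Perm (Fin n)) (u v : Fin n → ℕ) :
    act π (u + v) = act π u + act π v := rfl

@[simp] theorem act_zero (π : Equiv.Perm (Fin n)) : act π (0 : Fin n → ℕ) = 0 := rfl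

theorem qMul_act (π : Equiv.Perm (Fin n)) (u v : Fin n → ℕ) :
    P.qMul (act π u) (act π v) = ∏ i, ∏ j, P.w (π i) (π j) ^ (u j * v i) := by
  rw [qMul, ← Equiv.prod_comp π]
  refine Finset.prod_congr rfl fun i _ => ?_
  rw [← Equiv.prod_comp π]
  simp [act]

theorem e_eq_cast (i : Fin n) :
    (e i : Fin n → ℤ) = fun k => ((Pi.single i 1 : Fin n → ℕ) k : ℤ) := by
  funext k
  by_cases hk : k = i <;> simp [e, hk]

theorem qPair_act_e (π : Equiv.Perm (Fin n)) (j k : Fin n) :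
    P.qPair (act π (e k)) (act π (e j)) = P.w (π j) (π k) := by
  rw [e, e, act_single, act_single, ← e, ← e, e_eq_cast, e_eq_cast, qPair_cast, qMul_single_single]

/-- The base of the factor indexed by `j`, `k` in `permCoeff`. -/
def wPerm (π : Equiv.Perm (Fin n)) (j k : Fin n) : K := if j < k then P.w (π j) (π k) else 1

theorem permCoeff_eq (π : Equiv.Perm (Fin n)) (v : Fin n → ℕ) :
    P.permCoeff π v = ∏ j, ∏ k, P.wPerm π j k ^ (v j * v k) := by
  refine Finset.prod_congr rfl fun j _ => ?_
  rw [prod_Ioi_eq]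
  refine Finset.prod_congr rfl fun k _ => ?_
  rw [qPair_act_e, wPerm]
  split_ifs <;> simp

variable {P} in
-- At most one `wPerm` factor is nontrivial. If `k < j` and `π` keeps their order, compatibility
-- turns the product into `q_{kj} q_{jk} = 1`; if `π` reverses it, `q_{kj}` is already the
-- right-hand side.
theorem Compatible.w_mul {π : Equiv.Perm (Fin n)} (hπ : P.Compatible π) (j k : Fin n) :
    P.w k j * (P.wPerm π j k * P.wPerm π k j) = P.w (π j) (π k) := by
  have h1 := P.q_mul j k
  rcases lt_trichotomy j k with h | h | h
  · simp [w, wPerm, h, h.asymm]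
  · subst h
    simp [w, wPerm]
  · simp only [wPerm, if_pos h, if_neg h.asymm, one_mul]
    rcases lt_or_gt_of_ne (π.injective.ne h.ne) with h' | h'
    · simp only [w, if_pos h, if_pos h', if_neg h'.asymm, hπ.2, mul_comm]
      exact h1
    · simp only [w, if_pos h, if_pos h', if_neg h'.asymm, hπ.2, mul_one]

variable {P} in
theorem Compatible.w_mul_w {π : Equiv.Perm (Fin n)} (hπ : P.Compatible π) (j k : Fin n) :
    P.w (π j) (π k) * P.w j k = P.w (π k) (π j) * P.w k j := by
  rw [← hπ.w_mul j k, ← hπ.w_mul k j]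
  ring

variable {P} in
-- Says that `q^⟨π(v)|π(u)⟩ q^⟨v|u⟩` is symmetric in `u` and `v`; this is what makes `s(v) s(π(v))`
-- multiplicative in `v`, where `s` is `antipodeCoeff`.
theorem Compatible.qMul_act_mul {π : Equiv.Perm (Fin n)} (hπ : P.Compatible π) (u v : Fin n → ℕ) :
    P.qMul (act π v) (act π u) * P.qMul v u = P.qMul (act π u) (act π v) * P.qMul u v := by
  rw [qMul_act, qMul_act, qMul, qMul, ← Finset.prod_mul_distrib, ← Finset.prod_mul_distrib]
  simp only [← Finset.prod_mul_distrib, ← mul_pow]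
  rw [Finset.prod_comm]
  refine Finset.prod_congr rfl fun i _ => Finset.prod_congr rfl fun j _ => ?_
  rw [hπ.w_mul_w, mul_comm (v i)]

/-- The coefficient of `x_{π(v)}` in `S(x_v)`. -/
def antipodeCoeff (π : Equiv.Perm (Fin n)) (c : Fin n → K) (v : Fin n → ℕ) : K :=
  (∏ i, c i ^ v i) * P.permCoeff π v

@[simp] theorem antipodeCoeff_zero (π : Equiv.Perm (Fin n)) (c : Fin n → K) :
    P.antipodeCoeff π c 0 = 1 := by simp [antipodeCoeff, permCoeff]

theorem antipodeCoeff_single (π : Equiv.Perm (Fin n)) (c : Fin n → K) (i : Fin n) :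
    P.antipodeCoeff π c (Pi.single i 1) = c i := by
  have h1 : ∏ k, c k ^ (Pi.single i 1 : Fin n → ℕ) k = c i := by
    rw [Finset.prod_eq_single i] <;> simp +contextual
  have h2 : P.permCoeff π (Pi.single i 1) = 1 := by
    rw [permCoeff_eq]
    refine Finset.prod_eq_one fun j _ => Finset.prod_eq_one fun k _ => ?_
    by_cases hj : j = i
    · subst hj
      by_cases hk : k = j
      · simp [wPerm, hk]
      · simp [hk]
    · simp [hj]
  rw [antipodeCoeff, h1, h2, mul_one]

theorem antipodeCoeff_ne (π : Equiv.Perm (Fin n)) {c : Fin n → K} (hc : ∀ i, c i ≠ 0)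
    (v : Fin n → ℕ) : P.antipodeCoeff π c v ≠ 0 := by
  refine mul_ne_zero (Finset.prod_ne_zero_iff.2 fun i _ => pow_ne_zero _ (hc i)) ?_
  rw [permCoeff_eq]
  refine Finset.prod_ne_zero_iff.2 fun j _ => Finset.prod_ne_zero_iff.2 fun k _ => pow_ne_zero _ ?_
  unfold wPerm
  split_ifs
  exacts [P.w_ne _ _, one_ne_zero]

variable {P} in
-- This is exactly `S(x_u x_v) = S(x_v) S(x_u)` on coefficients. `permCoeff` is quadratic in the
-- exponent, and by `Compatible.w_mul` its polarization times `q^⟨u|v⟩` is `q^⟨π(v)|π(u)⟩`.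
theorem Compatible.antipodeCoeff_add {π : Equiv.Perm (Fin n)} (hπ : P.Compatible π)
    (c : Fin n → K) (u v : Fin n → ℕ) :
    P.qMul u v * P.antipodeCoeff π c (u + v) =
      P.antipodeCoeff π c u * P.antipodeCoeff π c v * P.qMul (act π v) (act π u) := by
  have h1 : P.permCoeff π (u + v) = P.permCoeff π u * P.permCoeff π v *
      ((∏ j, ∏ k, P.wPerm π j k ^ (v k * u j)) * ∏ j, ∏ k, P.wPerm π k j ^ (v k * u j)) := by
    rw [Finset.prod_comm (f := fun j k => P.wPerm π k j ^ (v k * u j))]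
    simp only [permCoeff_eq, ← Finset.prod_mul_distrib, ← pow_add, Pi.add_apply]
    refine Finset.prod_congr rfl fun j _ => Finset.prod_congr rfl fun k _ => ?_
    congr 1
    ring
  have h2 : P.qMul u v = ∏ j, ∏ k, P.w k j ^ (v k * u j) := by
    rw [Finset.prod_comm, qMul]
    simp only [mul_comm]
  have h3 : P.qMul u v * ((∏ j, ∏ k, P.wPerm π j k ^ (v k * u j)) *
      ∏ j, ∏ k, P.wPerm π k j ^ (v k * u j)) = P.qMul (act π v) (act π u) := by
    simp only [qMul_act, h2, ← Finset.prod_mul_distrib, ← mul_pow, hπ.w_mul]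
  have h4 : ∏ i, c i ^ (u + v) i = (∏ i, c i ^ u i) * ∏ i, c i ^ v i := by
    simp [pow_add, Finset.prod_mul_distrib]
  rw [antipodeCoeff, antipodeCoeff, antipodeCoeff, ← h3, h1, h4]
  ring

/-- The vector `a - 1` in `ℕ^n`. -/
def topNat : Fin n → ℕ := fun i => P.a i - 1

theorem toNat_le (v : P.V) : P.toNat v ≤ P.topNat := fun i => Nat.le_sub_one_of_lt (v i).2

theorem lt_a_of_le {v : Fin n → ℕ} (hv : v ≤ P.topNat) (i : Fin n) : v i < P.a i := by
  have := P.two_le_a i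
  have := hv i
  simp only [topNat] at this
  omega

theorem top_sub_cast {v : Fin n → ℕ} (hv : v ≤ P.topNat) :
    (P.top - fun i => (v i : ℤ)) = fun i => ((P.topNat - v) i : ℤ) := by
  funext i
  have := P.two_le_a i
  have := hv i
  simp only [topNat, top, Pi.sub_apply] at this ⊢
  omega

/-- The factor `q^⟨v|v⟩` cancels from numerator and denominator. Without the subtraction, `h_v` is
visibly multiplicative in `v`. -/
theorem h_cast {v : Fin n → ℕ} (hv : v ≤ P.topNat) :
    P.h (fun i => (v i : ℤ)) = P.qMul P.topNat v / P.qMul v P.topNat := by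
  have h1 : P.topNat = P.topNat - v + v := (tsub_add_cancel_of_le hv).symm
  rw [h, P.top_sub_cast hv, qPair_cast, qPair_cast]
  conv_rhs => rw [h1, qMul_add_left, qMul_add_right]
  rw [mul_div_mul_right _ _ (P.qMul_ne v v)]

theorem single_le_top (i : Fin n) : Pi.single i 1 ≤ P.topNat := by
  intro k
  have := P.two_le_a k
  by_cases hk : k = i
  · subst hk
    simp [topNat]
    omega
  · simp [hk]

theorem h_e (i : Fin n) : P.h (e i) =
    P.qMul P.topNat (Pi.single i 1) / P.qMul (Pi.single i 1) P.topNat := by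
  rw [e_eq_cast, P.h_cast (P.single_le_top i)]

/-- Multiplicative functions on `ℕ^n` are additive maps into `Additive K`, hence determined on unit
vectors. -/
theorem eq_of_mul_of_single {f g : (Fin n → ℕ) → K} (hf0 : f 0 = 1) (hg0 : g 0 = 1)
    (hf : ∀ u v, f (u + v) = f u * f v) (hg : ∀ u v, g (u + v) = g u * g v)
    (h : ∀ i, f (Pi.single i 1) = g (Pi.single i 1)) (v : Fin n → ℕ) : f v = g v := by
  let F : (Fin n → ℕ) →+ Additive K :=
    { toFun := fun v => Additive.ofMul (f v), map_zero' := hf0, map_add' := hf }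
  let G : (Fin n → ℕ) →+ Additive K :=
    { toFun := fun v => Additive.ofMul (g v), map_zero' := hg0, map_add' := hg }
  have : F = G := by
    refine AddMonoidHom.functions_ext' _ _ _ fun i => ?_
    ext
    exact h i
  exact DFunLike.congr_fun this v

variable {P} in
theorem Admissible.ne_zero {π : Equiv.Perm (Fin n)} {c : Fin n → K} (H : P.Admissible π c)
    (i : Fin n) : c i ≠ 0 := by
  refine left_ne_zero_of_mul (b := c (π i)) ?_
  rw [H.mul_eq, h_e]
  exact div_ne_zero (P.qMul_ne _ _) (P.qMul_ne _ _)

variable {P} in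
-- Both sides are multiplicative in `v`, so the condition on unit vectors, `c_i c_{π(i)} = h_{e_i}`,
-- propagates to all exponents.
theorem Admissible.antipodeCoeff_mul_act {π : Equiv.Perm (Fin n)} {c : Fin n → K}
    (H : P.Admissible π c) (v : Fin n → ℕ) :
    P.antipodeCoeff π c v * P.antipodeCoeff π c (act π v) =
      P.qMul P.topNat v / P.qMul v P.topNat := by
  refine eq_of_mul_of_single (f := fun v => P.antipodeCoeff π c v * P.antipodeCoeff π c (act π v))
    (g := fun v => P.qMul P.topNat v / P.qMul v P.topNat) (by simp) (by simp) ?_ ?_ ?_ v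
  · intro u v
    have h1 := H.compatible.antipodeCoeff_add c u v
    have h2 := H.compatible.antipodeCoeff_add c (act π u) (act π v)
    have h3 := H.compatible.qMul_act_mul u v
    rw [act_act H.sq_eq_one, act_act H.sq_eq_one] at h2
    have h4 := mul_ne_zero (P.qMul_ne (act π u) (act π v)) (P.qMul_ne u v)
    -- These nonzero factors allow the twisted additivity to be used at `(u, v)` and at `(π(u),
    -- π(v))`; `π² = 1` returns the second to the original exponents.
    apply mul_left_cancel₀ h4
    rw [act_add]
    calc _ = (P.qMul u v * P.antipodeCoeff π c (u + v)) *
        (P.qMul (act π u) (act π v) * P.antipodeCoeff π c (act π u + act π v)) := by ring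
      _ = _ := by
        rw [h1, h2, ← h3]
        ring
  · intro u v
    simp only [qMul_add_left, qMul_add_right]
    rw [mul_div_mul_comm]
  · intro i
    simp only [act_single, antipodeCoeff_single]
    rw [H.mul_eq, h_e]

/-! ### The antipode map -/

variable {P} in
theorem Compatible.act_lt {π : Equiv.Perm (Fin n)} (hπ : P.Compatible π) (v : Fin n → ℕ) :
    (∀ i, act π v i < P.a i) ↔ ∀ i, v i < P.a i := by
  rw [← π.forall_congr_right]
  simp [act, hπ.1]

variable {P} in
theorem Compatible.antipodeMap_mon {π : Equiv.Perm (Fin n)} (hπ : P.Compatible π) (c : Fin n → K)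
    (v : Fin n → ℕ) :
    P.antipodeMap π c (P.mon v) = P.antipodeCoeff π c v • P.mon (act π v) := by
  by_cases hv : ∀ i, v i < P.a i
  · rw [← P.stdBasis_ofNat v hv, antipodeMap, Module.Basis.constr_basis]
    rfl
  · rw [not_ne_iff.1 fun h => hv ((P.mon_ne_zero_iff v).1 h),
      not_ne_iff.1 fun h => hv ((hπ.act_lt v).1 ((P.mon_ne_zero_iff _).1 h)), map_zero, smul_zero]

variable {P} in
theorem Compatible.antipodeMap_mul {π : Equiv.Perm (Fin n)} (hπ : P.Compatible π) (c : Fin n → K)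
    (y z : P.Alg) :
    P.antipodeMap π c (y * z) = P.antipodeMap π c z * P.antipodeMap π c y := by
  have : (LinearMap.mul K P.Alg).compr₂ (P.antipodeMap π c) =
      ((LinearMap.mul K P.Alg).compl₁₂ (P.antipodeMap π c) (P.antipodeMap π c)).flip := by
    refine P.stdBasis.ext fun u => P.stdBasis.ext fun v => ?_
    change P.antipodeMap π c (P.stdBasis u * P.stdBasis v) =
      P.antipodeMap π c (P.stdBasis v) * P.antipodeMap π c (P.stdBasis u)
    simp only [stdBasis_apply, mon_mul_mon, map_smul, hπ.antipodeMap_mon, smul_mul_assoc,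
      mul_smul_comm, smul_smul, hπ.antipodeCoeff_add]
    rw [← act_add, add_comm (P.toNat v), mul_assoc]
  exact LinearMap.congr_fun₂ this y z

theorem antipodeMap_one (π : Equiv.Perm (Fin n)) (c : Fin n → K) : P.antipodeMap π c 1 = 1 := by
  have h : P.stdBasis P.zeroV = 1 := by
    rw [stdBasis_apply, ← P.mon_zero]
    rfl
  rw [← h, antipodeMap, Module.Basis.constr_basis, h]
  have h0 : P.toNat P.zeroV = 0 := rfl
  have := P.antipodeCoeff_zero π c
  rw [antipodeCoeff] at this
  rw [h0, this, act_zero, mon_zero, one_smul]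

variable {P} in
theorem Compatible.antipodeMap_x {π : Equiv.Perm (Fin n)} (hπ : P.Compatible π) (c : Fin n → K)
    (i : Fin n) : P.antipodeMap π c (P.x i) = c i • P.x (π i) := by
  rw [← mon_single_one, hπ.antipodeMap_mon, antipodeCoeff_single, act_single, mon_single_one]

variable {P} in
/-- Anti-endomorphisms of `A(q, a)` that agree on the generators are equal. -/
theorem antihom_ext {S T : P.Alg →ₗ[K] P.Alg} (hS1 : S 1 = 1) (hT1 : T 1 = 1)
    (hS : ∀ y z, S (y * z) = S z * S y) (hT : ∀ y z, T (y * z) = T z * T y)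
    (h : ∀ i, S (P.x i) = T (P.x i)) : S = T := by
  let F : P.Alg →ₐ[K] P.Algᵐᵒᵖ :=
    AlgHom.ofLinearMap ((MulOpposite.opLinearEquiv K).toLinearMap ∘ₗ S) (by simp [hS1])
      (by simp [hS])
  let G : P.Alg →ₐ[K] P.Algᵐᵒᵖ :=
    AlgHom.ofLinearMap ((MulOpposite.opLinearEquiv K).toLinearMap ∘ₗ T) (by simp [hT1])
      (by simp [hT])
  have : F = G := by
    refine RingQuot.ringQuot_ext' _ _ _ (FreeAlgebra.hom_ext ?_)
    funext i
    exact congrArg MulOpposite.op (h i)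
  ext y
  exact MulOpposite.op_injective (DFunLike.congr_fun this y)

end QCIParam

/-! ### General facts on bi-Frobenius algebras -/

section BiFrobenius

open Coalgebra

variable {K A : Type*} [Field K]

/-- The right action on an element of a coalgebra, as a linear map. -/
noncomputable def coalgRightActHom [AddCommGroup A] [Module K A] [Coalgebra K A] (t : A) :
    Module.Dual K A →ₗ[K] A :=
  (TensorProduct.lid K A).toLinearMap ∘ₗ
    (LinearMap.applyₗ (comul t)) ∘ₗ (LinearMap.rTensorHom A : (A →ₗ[K] K) →ₗ[K] _)

theorem coalgRightAct_eq_sum [AddCommGroup A] [Module K A] [Coalgebra K A] {t : A}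
    {ι : Type*} (s : Finset ι) (l r : ι → A) (h : ∑ i ∈ s, l i ⊗ₜ[K] r i = comul t)
    (f : Module.Dual K A) : coalgRightAct K t f = ∑ i ∈ s, f (l i) • r i := by
  simp [coalgRightAct, ← h]

/-- A surjection `A^* → A` between spaces of equal dimension is injective. -/
theorem IsFrobeniusCoalgebraPair.eq_zero [AddCommGroup A] [Module K A] [Coalgebra K A]
    [Module.Finite K A] {t : A} (ht : IsFrobeniusCoalgebraPair K t) {f : Module.Dual K A}
    (hf : coalgRightAct K t f = 0) : f = 0 := by
  have hT : Function.Surjective (coalgRightActHom (K := K) t) := ht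
  exact (LinearMap.injective_iff_surjective_of_finrank_eq_finrank
    Subspace.dual_finrank_eq).2 hT (hf.trans (map_zero (coalgRightActHom t)).symm)

theorem IsFrobeniusAlgebraPair.eq_zero [Ring A] [Algebra K A] {φ : Module.Dual K A}
    (hφ : IsFrobeniusAlgebraPair K φ) {y : A} (hy : ∀ x, φ (y * x) = 0) : y = 0 := by
  refine (Module.forall_dual_apply_eq_zero_iff K y).1 fun f => ?_
  obtain ⟨b, hb⟩ := hφ f
  rw [hb, hy]

namespace IsBiFrobenius

variable [Ring A] [Algebra K A] [Coalgebra K A] {φ : Module.Dual K A} {t : A} {S : A →ₗ[K] A}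

theorem antipode_surjective (H : IsBiFrobenius K φ t S) : Function.Surjective S := by
  intro x
  obtain ⟨f, rfl⟩ := H.frobenius_coalgebra x
  obtain ⟨b, hb⟩ := H.frobenius_algebra f
  refine ⟨b, ?_⟩
  rw [H.antipode_eq]
  congr 1
  ext y
  exact (hb y).symm

theorem antipode_injective (H : IsBiFrobenius K φ t S) : Function.Injective S :=
  have := H.finite
  LinearMap.injective_iff_surjective.2 H.antipode_surjective

theorem antipode_eq_sum (H : IsBiFrobenius K φ t S) {ι : Type*} (R : Repr K t ι) (b : A) :
    S b = ∑ i ∈ R.index, φ (R.left i * b) • R.right i := by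
  rw [H.antipode_eq, coalgRightAct_eq_sum _ _ _ R.eq]
  rfl

/-! ### Integrals and the square of the antipode -/

/-- Apply `ε` to `S(b) = ∑ φ(t₁ b) t₂` and use `ε ∘ S = ε` and the counit axiom. -/
theorem apply_mul (H : IsBiFrobenius K φ t S) (b : A) :
    φ (t * b) = counit (R := K) b := by
  have R := Repr.arbitrary K t
  have h := congrArg (TensorProduct.rid K A) (sum_tmul_counit_eq R)
  simp only [map_sum, TensorProduct.rid_tmul, one_smul] at h
  rw [← H.counit_antipode, H.antipode_eq_sum R]
  conv_lhs => rw [← h]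
  simp [Finset.sum_mul, mul_comm]

/-- The element `t` is a right integral. -/
theorem integral_mul (H : IsBiFrobenius K φ t S) (b : A) :
    t * b = counit (R := K) b • t := by
  rw [← sub_eq_zero]
  refine H.frobenius_algebra.eq_zero fun x => ?_
  rw [sub_mul, smul_mul_assoc, mul_assoc, map_sub, map_smul, H.apply_mul, H.apply_mul,
    H.counit_mul, smul_eq_mul, sub_self]

/-- With `T = S⁻¹`, nondegeneracy of `φ` gives `b = ∑ φ(b T(t₂)) t₁`. Substituting `μ t₁ ⊗ t₂ =
S(t₂) ⊗ S(t₁)`, which is `Δ(S(t))` computed twice, gives the formula. -/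
theorem smul_eq_antipode (H : IsBiFrobenius K φ t S) {ι : Type*} (R : Repr K t ι) {μ : K} (hμ : S t = μ • t)
    (b : A) : μ • b = S (∑ i ∈ R.index, φ (b * R.left i) • R.right i) := by
  obtain ⟨T, hT⟩ : ∃ T : A →ₗ[K] A, ∀ y, T (S y) = y :=
    ⟨(LinearEquiv.ofBijective S ⟨H.antipode_injective, H.antipode_surjective⟩).symm.toLinearMap,
      fun y => LinearEquiv.symm_apply_apply
        (LinearEquiv.ofBijective S ⟨H.antipode_injective, H.antipode_surjective⟩) y⟩
  have h1 : b = ∑ i ∈ R.index, φ (b * T (R.right i)) • R.left i := by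
    rw [eq_comm, ← sub_eq_zero]
    refine H.frobenius_algebra.eq_zero fun x => ?_
    -- Expands `x` as `T(S(x)) = ∑ φ(t₁ x) T(t₂)`.
    conv_lhs => rw [sub_mul, map_sub]; enter [2]; rw [← hT x, H.antipode_eq_sum R x]
    simp [Finset.sum_mul, Finset.mul_sum, mul_comm]
  have h2 := H.comul_antipode t
  rw [hμ, map_smul, ← R.eq] at h2
  let F : A ⊗[K] A →ₗ[K] A := TensorProduct.lift
    ((LinearMap.lsmul K A).flip.compl₂ (φ ∘ₗ LinearMap.mulLeft K b ∘ₗ T))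
  have hF : ∀ y z, F (y ⊗ₜ z) = φ (b * T z) • y := fun y z => rfl
  have h3 := congrArg F h2
  simpa [hF, hT, ← h1] using h3

/-- Taking `b = 1` in `smul_eq_antipode` yields `μ • 1 = S(S(1)) = 1`. -/
theorem eq_one_of_antipode_integral (H : IsBiFrobenius K φ t S) {μ : K} (hμ : S t = μ • t)
    (h1 : (1 : A) ≠ 0) : μ = 1 := by
  have R := Repr.arbitrary K t
  have h := H.smul_eq_antipode R hμ 1
  have h2 := H.antipode_eq_sum R 1
  simp only [one_mul, mul_one] at h h2
  rw [← h2, H.antipode_one, H.antipode_one] at h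
  refine smul_left_injective K h1 ?_
  simpa using h

/-- The square of the antipode is the Nakayama automorphism. -/
theorem apply_antipode_antipode_mul (H : IsBiFrobenius K φ t S) (ht : S t = t) (b x : A) :
    φ (S (S b) * x) = φ (x * b) := by
  have R := Repr.arbitrary K t
  have := H.finite
  have h := H.smul_eq_antipode R (μ := 1) (by rwa [one_smul]) (S (S b))
  rw [one_smul] at h
  -- Cancelling one `S` gives `∑ φ(t₁ b) t₂ = ∑ φ(S²(b) t₁) t₂`; injectivity of `f ↦ t ↼ f` then
  -- identifies the two functionals.
  have h1 := (H.antipode_eq_sum R b).symm.trans (H.antipode_injective h)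
  have h2 : φ ∘ₗ LinearMap.mulRight K b - φ ∘ₗ LinearMap.mulLeft K (S (S b)) = 0 := by
    refine H.frobenius_coalgebra.eq_zero ?_
    rw [coalgRightAct_eq_sum _ _ _ R.eq]
    simp only [LinearMap.sub_apply, sub_smul, Finset.sum_sub_distrib]
    exact sub_eq_zero.2 h1
  exact (sub_eq_zero.1 (DFunLike.congr_fun h2 x)).symm

end IsBiFrobenius

end BiFrobenius

namespace QCIParam

variable {K : Type*} [Field K] {n : ℕ} (P : QCIParam K n)

instance : Nontrivial P.Alg :=
  ⟨P.mon 0, 0, (P.mon_ne_zero_iff 0).2 fun i => by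
    have := P.two_le_a i
    simp only [Pi.zero_apply]
    omega⟩

theorem toNat_lt (v : P.V) (i : Fin n) : P.toNat v i < P.a i := (v i).2

theorem mon_toNat_ne_zero (v : P.V) : P.mon (P.toNat v) ≠ 0 :=
  (P.mon_ne_zero_iff _).2 (P.toNat_lt v)

theorem single_lt (i k : Fin n) : (Pi.single i 1 : Fin n → ℕ) k < P.a k :=
  P.lt_a_of_le (P.single_le_top i) k

theorem x_pow_ne_zero_iff (i : Fin n) (k : ℕ) : P.x i ^ k ≠ 0 ↔ k < P.a i := by
  rw [← mon_single, mon_ne_zero_iff]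
  refine ⟨fun h => by simpa using h i, fun h j => ?_⟩
  by_cases hj : j = i
  · subst hj
    simpa using h
  · have := P.two_le_a j
    simp only [Pi.single_eq_of_ne hj]
    omega

theorem mon_eq_smul_mul (u v : Fin n → ℕ) :
    P.mon (u + v) = (P.qMul u v)⁻¹ • (P.mon u * P.mon v) := by
  rw [mon_mul_mon, smul_smul, inv_mul_cancel₀ (P.qMul_ne u v), one_smul]

/-! ### Permutation maps that are anti-automorphisms -/

section Anti

variable {P} {S : P.Alg →ₗ[K] P.Alg} (hS : Function.Injective S) (hS1 : S 1 = 1)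
  (hSm : ∀ y z, S (y * z) = S z * S y) {σ : Equiv.Perm P.V} {c : P.V → K}
  (hσ : ∀ v : P.V, S (P.mon (P.toNat v)) = c v • P.mon (P.toNat (σ v)))

include hS hσ in
theorem permutationMap_coeff_ne (v : P.V) : c v ≠ 0 := by
  intro h
  have h1 := hσ v
  rw [h, zero_smul] at h1
  exact P.mon_toNat_ne_zero v (hS (h1.trans (map_zero S).symm))

include hS hSm hσ in
theorem permutationMap_add (u v s : P.V) (hs : P.toNat s = P.toNat u + P.toNat v) :
    P.toNat (σ s) = P.toNat (σ u) + P.toNat (σ v) := by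
  have h1 := hσ s
  rw [hs, mon_eq_smul_mul, map_smul, hSm, hσ, hσ, smul_mul_smul_comm, mon_mul_mon, smul_smul,
    smul_smul] at h1
  rw [add_comm (P.toNat (σ u))]
  exact (P.eq_of_smul_mon_eq h1.symm (P.toNat_lt _) (permutationMap_coeff_ne hS hσ s)).1

include hS hS1 hσ in
theorem permutationMap_zero : σ P.zeroV = P.zeroV := by
  have h1 := hσ P.zeroV
  have h0 : P.toNat P.zeroV = 0 := rfl
  rw [h0, mon_zero, hS1, ← P.mon_zero, ← one_smul K (P.mon 0)] at h1
  apply P.toNat_injective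
  rw [h0]
  exact (P.eq_of_smul_mon_eq h1.symm (P.toNat_lt _) (permutationMap_coeff_ne hS hσ _)).1

theorem toNat_ofNat (v : Fin n → ℕ) (hv : ∀ i, v i < P.a i) : P.toNat (P.ofNat v hv) = v := rfl

include hS hS1 hSm hσ in
-- Split off unit vectors one at a time: `σ` is additive, and a unit vector cannot go to zero
-- because `σ` fixes zero and is injective.
theorem permutationMap_sum_le (d : ℕ) (v : P.V) (hd : ∑ i, P.toNat v i = d) :
    d ≤ ∑ i, P.toNat (σ v) i := by
  induction d generalizing v with
  | zero => exact Nat.zero_le _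
  | succ d ih =>
    obtain ⟨i, hi⟩ : ∃ i, P.toNat v i ≠ 0 := by
      by_contra! h
      simp [h] at hd
    have hle : Pi.single i 1 ≤ P.toNat v := by
      intro k
      by_cases hk : k = i
      · subst hk
        simpa [Nat.one_le_iff_ne_zero] using hi
      · simp [hk]
    let u : P.V := P.ofNat (P.toNat v - Pi.single i 1)
      fun k => (Nat.sub_le _ _).trans_lt (P.toNat_lt v k)
    let e : P.V := P.ofNat (Pi.single i 1) (P.single_lt i)
    have hv : P.toNat v = P.toNat u + P.toNat e := (tsub_add_cancel_of_le hle).symm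
    have he : ∑ k, P.toNat e k = 1 := by simp [e, toNat_ofNat]
    have hu : ∑ k, P.toNat u k = d := by
      simp only [hv, Pi.add_apply, Finset.sum_add_distrib, he] at hd
      omega
    have he' : 1 ≤ ∑ k, P.toNat (σ e) k := by
      rw [Nat.one_le_iff_ne_zero]
      intro h
      have h0 : σ e = P.zeroV := by
        apply P.toNat_injective
        funext k
        exact Finset.sum_eq_zero_iff.1 h k (Finset.mem_univ k)
      rw [← permutationMap_zero hS hS1 hσ] at h0
      rw [σ.injective h0] at he
      simp [toNat, zeroV] at he
    rw [permutationMap_add hS hSm hσ u e v hv]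
    simp only [Pi.add_apply, Finset.sum_add_distrib]
    have := ih u hu
    omega

include hS hS1 hSm hσ in
-- The degree is nowhere lowered, and its sum over the finite set `V` is unchanged by a permutation,
-- so every inequality is an equality.
theorem permutationMap_sum (v : P.V) : ∑ i, P.toNat (σ v) i = ∑ i, P.toNat v i := by
  have h := (Finset.sum_eq_sum_iff_of_le (s := Finset.univ) (f := fun v : P.V => ∑ i, P.toNat v i)
    (g := fun v => ∑ i, P.toNat (σ v) i)
    fun v _ => permutationMap_sum_le hS hS1 hSm hσ _ v rfl).1
      (Equiv.sum_comp σ fun v : P.V => ∑ i, P.toNat v i).symm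
  exact (h v (Finset.mem_univ v)).symm

include hS hS1 hSm hσ in
theorem exists_perm_of_permutationMap :
    ∃ (π : Equiv.Perm (Fin n)) (d : Fin n → K), (∀ i, d i ≠ 0) ∧
      ∀ i, S (P.x i) = d i • P.x (π i) := by
  have h1 : ∀ i, ∃ j, P.toNat (σ (P.ofNat (Pi.single i 1) (P.single_lt i))) = Pi.single j 1 := by
    intro i
    have h := permutationMap_sum hS hS1 hSm hσ (P.ofNat (Pi.single i 1) (P.single_lt i))
    rw [toNat_ofNat] at h
    generalize P.toNat (σ _) = w at h ⊢
    simp only [Finset.sum_pi_single', Finset.mem_univ, if_true] at h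
    obtain ⟨j, -, hj⟩ := Finset.exists_ne_zero_of_sum_ne_zero (h.trans_ne one_ne_zero)
    refine ⟨j, ?_⟩
    rw [← Finset.add_sum_erase _ _ (Finset.mem_univ j)] at h
    have h0 : ∑ k ∈ Finset.univ.erase j, w k = 0 := by omega
    funext k
    by_cases hk : k = j
    · subst hk
      rw [Pi.single_eq_same]
      omega
    · rw [Pi.single_eq_of_ne hk]
      exact Finset.sum_eq_zero_iff.1 h0 k (by simp [hk])
  choose p hp using h1
  have hinj : Function.Injective p := by
    intro i j hij
    have h := (hp i).trans ((congrArg (fun k => (Pi.single k 1 : Fin n → ℕ)) hij).trans (hp j).symm)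
    have h' := congrArg P.toNat (σ.injective (P.toNat_injective h))
    have h'' := congrFun h' i
    by_contra hne
    simp [toNat_ofNat, hne] at h''
  refine ⟨Equiv.ofBijective p (Finite.injective_iff_bijective.1 hinj),
    fun i => c (P.ofNat (Pi.single i 1) (P.single_lt i)),
    fun i => permutationMap_coeff_ne hS hσ _, fun i => ?_⟩
  have h := hσ (P.ofNat (Pi.single i 1) (P.single_lt i))
  rw [hp] at h
  rwa [toNat_ofNat, mon_single_one, mon_single_one] at h

include hS hS1 hSm in
-- The nilpotency orders of `x_i` and `x_{π(i)}` agree because `S` is injective. Reversing the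
-- commutation relation through `S` compares `q_{π(i)π(j)}` with `q_{ji}`, since `x_{π(i)} x_{π(j)}
-- ≠ 0`.
theorem compatible_of_antihom {π : Equiv.Perm (Fin n)} {d : Fin n → K} (hd : ∀ i, d i ≠ 0)
    (h : ∀ i, S (P.x i) = d i • P.x (π i)) : P.Compatible π := by
  constructor
  · intro i
    have hpow : ∀ k, S (P.x i ^ k) = d i ^ k • P.x (π i) ^ k := by
      intro k
      induction k with
      | zero => simp [hS1]
      | succ k ih => rw [pow_succ, hSm, ih, h, smul_mul_smul_comm, ← pow_succ', ← pow_succ']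
    have hiff : ∀ k, k < P.a (π i) ↔ k < P.a i := by
      intro k
      rw [← x_pow_ne_zero_iff, ← x_pow_ne_zero_iff, not_iff_not, ← map_eq_zero_iff S hS (x := P.x i ^ k),
        hpow, smul_eq_zero_iff_right (pow_ne_zero k (hd i))]
    have h1 := hiff (P.a i)
    have h2 := hiff (P.a (π i))
    omega
  · intro i j
    by_cases hij : i = j
    · subst hij
      rw [P.q_diag, P.q_diag]
    have h1 := congrArg S (P.x_comm j i)
    rw [map_smul, hSm, hSm, h, h, smul_mul_smul_comm, smul_mul_smul_comm, P.x_comm (π i) (π j),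
      smul_smul, smul_smul, ← sub_eq_zero, ← sub_smul] at h1
    have h2 : P.x (π i) * P.x (π j) ≠ 0 := by
      rw [← mon_single_one, ← mon_single_one, mon_mul_mon]
      refine smul_ne_zero (P.qMul_ne _ _) ((P.mon_ne_zero_iff _).2 fun k => ?_)
      have := P.two_le_a k
      have hne : π i ≠ π j := π.injective.ne hij
      by_cases hk : k = π i
      · subst hk
        simp [hne]
        omega
      · by_cases hk' : k = π j
        · subst hk'
          simp [hne.symm]
          omega
        · simp [hk, hk']
          omega
    have h3 := (smul_eq_zero.1 h1).resolve_right h2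
    have h4 := mul_ne_zero (hd i) (hd j)
    apply mul_left_cancel₀ h4
    linear_combination h3

end Anti

/-! ### Integrals and the Nakayama automorphism -/

theorem topMon_eq : P.topMon = P.mon P.topNat := rfl

variable {P} in
theorem Compatible.act_top {π : Equiv.Perm (Fin n)} (hπ : P.Compatible π) :
    act π P.topNat = P.topNat := by
  funext i
  have h := hπ.1 (π⁻¹ i)
  rw [Equiv.Perm.coe_inv, Equiv.apply_symm_apply] at h
  simp [act, topNat, h]

/-- An element annihilated by all generators from the right is a multiple of `x_{a-1}`. -/
theorem eq_smul_topMon {t : P.Alg} (ht : ∀ i, t * P.x i = 0) : ∃ r : K, t = r • P.topMon := by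
  have h : ∀ v : P.V, v ≠ P.topV → P.stdBasis.repr t v = 0 := by
    intro v hv
    obtain ⟨i, hi⟩ : ∃ i, P.toNat v i + 1 < P.a i := by
      by_contra! h
      refine hv (P.toNat_injective (funext fun i => ?_))
      have h1 := h i
      have h2 := P.toNat_lt v i
      simp only [toNat, topV] at h1 h2 ⊢
      omega
    have hlt : ∀ k, (P.toNat v + Pi.single i 1 : Fin n → ℕ) k < P.a k := by
      intro k
      by_cases hk : k = i
      · subst hk
        simpa using hi
      · simpa [hk] using P.toNat_lt v k
    -- Right multiplication by `x_i` shifts exponents injectively with nonzero scalars, so `t x_i =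
    -- 0` kills each coefficient of `t` whose exponent can still be raised at `i`.
    have key : ∀ y : P.Alg, P.stdBasis.repr (y * P.x i) (P.ofNat _ hlt) =
        P.qMul (P.toNat v) (Pi.single i 1) * P.stdBasis.repr y v := by
      intro y
      suffices hl : (P.stdBasis.coord (P.ofNat _ hlt)) ∘ₗ LinearMap.mulRight K (P.x i) =
          P.qMul (P.toNat v) (Pi.single i 1) • P.stdBasis.coord v from
        LinearMap.congr_fun hl y
      refine P.stdBasis.ext fun u => ?_
      simp only [LinearMap.comp_apply, LinearMap.mulRight_apply, LinearMap.smul_apply,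
        Module.Basis.coord_apply, Module.Basis.repr_self, smul_eq_mul]
      rw [stdBasis_apply, ← mon_single_one, mon_mul_mon, map_smul, Finsupp.smul_apply, smul_eq_mul]
      by_cases huv : u = v
      · subst huv
        rw [← P.stdBasis_ofNat _ hlt, Module.Basis.repr_self, Finsupp.single_eq_same,
          Finsupp.single_eq_same]
      · rw [Finsupp.single_eq_of_ne (Ne.symm huv), mul_zero]
        by_cases hu : ∀ k, (P.toNat u + Pi.single i 1 : Fin n → ℕ) k < P.a k
        · rw [← P.stdBasis_ofNat _ hu, Module.Basis.repr_self, Finsupp.single_eq_of_ne, mul_zero]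
          intro h'
          have h'' := congrArg P.toNat h'
          rw [toNat_ofNat, toNat_ofNat] at h''
          exact huv (P.toNat_injective (add_right_cancel h'').symm)
        · rw [not_ne_iff.1 fun h => hu ((P.mon_ne_zero_iff _).1 h), map_zero, Finsupp.zero_apply,
            mul_zero]
    have h1 := key t
    rw [ht i, map_zero, Finsupp.zero_apply] at h1
    exact (mul_eq_zero.1 h1.symm).resolve_left (P.qMul_ne _ _)
  refine ⟨P.stdBasis.repr t P.topV, ?_⟩
  conv_lhs => rw [← P.stdBasis.sum_repr t]
  rw [Finset.sum_eq_single P.topV (fun v _ hv => by rw [h v hv, zero_smul]) (by simp),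
    stdBasis_apply]
  rfl

/-- The functional of a Frobenius structure does not vanish on `x_{a-1}`. -/
theorem apply_topMon_ne_zero {φ : Module.Dual K P.Alg} (hφ : IsFrobeniusAlgebraPair K φ) :
    φ (P.mon P.topNat) ≠ 0 := by
  intro h0
  refine (P.mon_ne_zero_iff P.topNat).2 (P.lt_a_of_le le_rfl) (hφ.eq_zero fun y => ?_)
  suffices h : φ ∘ₗ LinearMap.mulLeft K (P.mon P.topNat) = 0 from LinearMap.congr_fun h y
  refine P.stdBasis.ext fun u => ?_
  rw [LinearMap.comp_apply, LinearMap.mulLeft_apply, stdBasis_apply, mon_mul_mon, map_smul,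
    LinearMap.zero_apply]
  by_cases hu : P.toNat u = 0
  · rw [hu, add_zero, h0, smul_zero]
  · obtain ⟨i, hi⟩ := Function.ne_iff.1 hu
    rw [P.mon_eq_zero _ i, map_zero, smul_zero]
    have := P.two_le_a i
    simp only [Pi.add_apply, topNat, Pi.zero_apply] at hi ⊢
    omega

/-! ### Necessity of the conditions -/

theorem AdmitsPermutationBiFrobenius.exists_admissible (H : P.AdmitsPermutationBiFrobenius) :
    ∃ (π : Equiv.Perm (Fin n)) (c : Fin n → K), P.Admissible π c := by
  obtain ⟨_, φ, t, S, H, σ, b, hσ⟩ := H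
  have hS := H.antipode_injective
  obtain ⟨π, c, hc, hx⟩ :=
    exists_perm_of_permutationMap hS H.antipode_one H.antipode_mul hσ
  have hπ : P.Compatible π := compatible_of_antihom hS H.antipode_one H.antipode_mul hc hx
  have hSeq : S = P.antipodeMap π c :=
    antihom_ext H.antipode_one (P.antipodeMap_one π c) H.antipode_mul (hπ.antipodeMap_mul c)
      fun i => (hx i).trans (hπ.antipodeMap_x c i).symm
  have hcounit : ∀ i, Coalgebra.counit (R := K) (P.x i) = 0 := by
    intro i
    have hpow : ∀ k, Coalgebra.counit (R := K) (P.x i ^ k) =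
        Coalgebra.counit (R := K) (P.x i) ^ k := by
      intro k
      induction k with
      | zero => simp [H.counit_one]
      | succ k ih => rw [pow_succ, H.counit_mul, ih, pow_succ]
    have h := hpow (P.a i)
    rw [P.x_pow, map_zero] at h
    exact eq_zero_of_pow_eq_zero h.symm
  obtain ⟨r, hr⟩ := P.eq_smul_topMon (t := t) fun i => by
    rw [H.integral_mul, hcounit, zero_smul]
  have hSt : S t = P.antipodeCoeff π c P.topNat • t := by
    rw [hr, map_smul, hSeq, topMon_eq, hπ.antipodeMap_mon, hπ.act_top, smul_comm]
  have hone := H.eq_one_of_antipode_integral hSt one_ne_zero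
  rw [hone, one_smul] at hSt
  have hφ := P.apply_topMon_ne_zero H.frobenius_algebra
  have hsq : ∀ i, π (π i) = i ∧ c i * c (π i) = P.h (e i) := by
    intro i
    have hNak := H.apply_antipode_antipode_mul hSt (P.x i)
    rw [hx, map_smul, hx, smul_smul, ← mon_single_one, ← mon_single_one] at hNak
    -- The test monomial is complementary to `x_{π²(i)}`, so the left side is a nonzero multiple of
    -- `φ(x_{a-1})`.
    have h1 := hNak (P.mon (P.topNat - Pi.single (π (π i)) 1))
    have hadd : ∀ j, Pi.single j 1 + (P.topNat - Pi.single j 1) = P.topNat := fun j =>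
      add_tsub_cancel_of_le (P.single_le_top j)
    rw [smul_mul_assoc, map_smul, mon_mul_mon, mon_mul_mon, map_smul, map_smul, hadd, smul_smul]
      at h1
    have hi : π (π i) = i := by
      by_contra hne
      -- If `π²(i) ≠ i`, the exponent at `i` on the right side is `(a_i - 1) + 1 = a_i`, so that
      -- side vanishes.
      rw [P.mon_eq_zero (_ - _ + _) i, map_zero, smul_zero] at h1
      · exact smul_ne_zero (mul_ne_zero (mul_ne_zero (hc _) (hc _)) (P.qMul_ne _ _)) hφ h1
      · have := P.two_le_a i
        simp only [Pi.add_apply, Pi.sub_apply, Pi.single_eq_same,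
          Pi.single_eq_of_ne (Ne.symm hne), topNat]
        omega
    refine ⟨hi, ?_⟩
    rw [hi, add_comm, hadd] at h1
    have h2 := mul_right_cancel₀ hφ h1
    have h3 := P.qMul_add_left (Pi.single i 1) (P.topNat - Pi.single i 1) (Pi.single i 1)
    have h4 := P.qMul_add_right (Pi.single i 1) (Pi.single i 1) (P.topNat - Pi.single i 1)
    rw [hadd] at h3 h4
    rw [h_e, eq_div_iff (P.qMul_ne _ _), h3, h4, ← h2]
    ring
  refine ⟨π, c, hπ, ?_, fun i => (hsq i).2, ?_⟩
  · ext i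
    simp [sq, (hsq i).1]
  · rw [mul_comm]
    exact hone

end QCIParam

namespace QCIParam

variable {K : Type*} [Field K] {n : ℕ} (P : QCIParam K n)

/-! ### The coalgebra structure -/

@[simp] theorem toNat_zeroV : P.toNat P.zeroV = 0 := rfl

@[simp] theorem toNat_topV : P.toNat P.topV = P.topNat := rfl

theorem toNat_eq_zero_iff (v : P.V) : P.toNat v = 0 ↔ v = P.zeroV :=
  ⟨fun h => P.toNat_injective h, fun h => by rw [h, toNat_zeroV]⟩

theorem toNat_eq_top_iff (v : P.V) : P.toNat v = P.topNat ↔ v = P.topV :=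
  ⟨fun h => P.toNat_injective h, fun h => by rw [h, toNat_topV]⟩

theorem topNat_ne_zero : P.topNat ≠ 0 := by
  intro h
  have h1 := congrFun h ⟨0, by have := P.two_le_n; omega⟩
  have h2 := P.two_le_a ⟨0, by have := P.two_le_n; omega⟩
  simp only [topNat, Pi.zero_apply] at h1
  omega

theorem topV_ne_zeroV : P.topV ≠ P.zeroV := fun h =>
  P.topNat_ne_zero (by rw [← toNat_topV, h, toNat_zeroV])

theorem coord_mon (w : P.V) (v : Fin n → ℕ) :
    P.stdBasis.coord w (P.mon v) = if v = P.toNat w then 1 else 0 := by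
  by_cases hv : ∀ i, v i < P.a i
  · rw [← P.stdBasis_ofNat v hv, Module.Basis.coord_apply, Module.Basis.repr_self,
      Finsupp.single_apply]
    congr 1
    exact propext ⟨fun h => congrArg P.toNat h, fun h => P.toNat_injective h⟩
  · rw [not_ne_iff.1 fun h => hv ((P.mon_ne_zero_iff v).1 h), map_zero, if_neg]
    rintro rfl
    exact hv (P.toNat_lt w)

theorem counitMap_eq : P.counitMap = P.stdBasis.coord P.zeroV := by
  refine P.stdBasis.ext fun v => ?_
  rw [counitMap, Module.Basis.constr_basis, Module.Basis.coord_apply, Module.Basis.repr_self,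
    Finsupp.single_apply]

theorem counitMap_mon (v : Fin n → ℕ) : P.counitMap (P.mon v) = if v = 0 then 1 else 0 := by
  rw [counitMap_eq, coord_mon, toNat_zeroV]

theorem counitMap_topMon : P.counitMap P.topMon = 0 := by
  rw [topMon_eq, counitMap_mon, if_neg P.topNat_ne_zero]

theorem counitMap_one : P.counitMap 1 = 1 := by
  rw [← mon_zero, counitMap_mon, if_pos rfl]

theorem counitMap_mul (y z : P.Alg) : P.counitMap (y * z) = P.counitMap y * P.counitMap z := by
  have : (LinearMap.mul K P.Alg).compr₂ P.counitMap =
      (LinearMap.mul K K).compl₁₂ P.counitMap P.counitMap := by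
    refine P.stdBasis.ext fun u => P.stdBasis.ext fun v => ?_
    change P.counitMap (P.stdBasis u * P.stdBasis v) =
      P.counitMap (P.stdBasis u) * P.counitMap (P.stdBasis v)
    simp only [stdBasis_apply, mon_mul_mon, map_smul, counitMap_mon, smul_eq_mul]
    by_cases hu : P.toNat u = 0
    · simp [hu]
    · rw [if_neg hu, zero_mul, if_neg fun h => hu (add_eq_zero.1 h).1, mul_zero]
  exact LinearMap.congr_fun₂ this y z

variable (π : Equiv.Perm (Fin n)) (c : Fin n → K)

theorem comulMap_one : P.comulMap π c 1 = 1 ⊗ₜ 1 := by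
  have h : P.stdBasis P.zeroV = 1 := by rw [stdBasis_apply, toNat_zeroV, mon_zero]
  rw [← h, comulMap, Module.Basis.constr_basis, if_pos rfl, h]

theorem comulMap_mon (v : Fin n → ℕ) (hv : ∀ i, v i < P.a i) (h0 : v ≠ 0) (h1 : v ≠ P.topNat) :
    P.comulMap π c (P.mon v) = 1 ⊗ₜ P.mon v + P.mon v ⊗ₜ 1 := by
  have h0' : P.ofNat v hv ≠ P.zeroV := fun h => h0 (congrArg P.toNat h)
  have h1' : P.ofNat v hv ≠ P.topV := fun h => h1 (congrArg P.toNat h)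
  rw [← P.stdBasis_ofNat v hv, comulMap, Module.Basis.constr_basis, if_neg h0', if_neg h1']
  simp only [stdBasis_apply]

theorem comulMap_topMon : P.comulMap π c P.topMon =
    ∑ v : P.V, P.g π c v • (P.mon (P.topNat - P.toNat v) ⊗ₜ[K] P.mon (act π (P.toNat v))) := by
  have h : P.stdBasis P.topV = P.topMon := P.stdBasis_apply _
  rw [← h, comulMap, Module.Basis.constr_basis, if_neg P.topV_ne_zeroV, if_pos rfl]
  rfl

theorem g_eq (v : P.V) : P.g π c v =
    (P.qMul (P.topNat - P.toNat v) (P.toNat v))⁻¹ * P.antipodeCoeff π c (P.toNat v) := by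
  rw [g, P.top_sub_cast (P.toNat_le v), qPair_cast, antipodeCoeff, one_div, mul_assoc]

/-- The complement `a - 1 - v` of `v`. -/
def complV (v : P.V) : P.V :=
  P.ofNat (P.topNat - P.toNat v) fun i => (Nat.sub_le _ _).trans_lt (P.lt_a_of_le le_rfl i)

theorem toNat_complV (v : P.V) : P.toNat (P.complV v) = P.topNat - P.toNat v := rfl

theorem top_sub_sub (v : P.V) : P.topNat - (P.topNat - P.toNat v) = P.toNat v :=
  tsub_tsub_cancel_of_le (P.toNat_le v)

theorem complV_involutive : Function.Involutive P.complV := fun v =>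
  P.toNat_injective (by rw [toNat_complV, toNat_complV, top_sub_sub])

theorem top_sub_eq_zero_iff (v : P.V) : P.topNat - P.toNat v = 0 ↔ v = P.topV := by
  rw [← toNat_eq_top_iff, tsub_eq_zero_iff_le]
  exact ⟨fun h => le_antisymm (P.toNat_le v) h, fun h => h.ge⟩

theorem top_sub_eq_top_iff (v : P.V) : P.topNat - P.toNat v = P.topNat ↔ v = P.zeroV := by
  rw [← toNat_eq_zero_iff]
  refine ⟨fun h => ?_, fun h => by rw [h, tsub_zero]⟩
  have h1 := P.top_sub_sub v
  rw [h, tsub_self] at h1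
  exact h1.symm

theorem act_eq_zero_iff (v : Fin n → ℕ) : act π v = 0 ↔ v = 0 := by
  refine ⟨fun h => ?_, fun h => by rw [h, act_zero]⟩
  funext i
  simpa [act] using congrFun h (π i)

namespace Admissible

variable {P π c} (H : P.Admissible π c)
include H

theorem antipodeCoeff_top : P.antipodeCoeff π c P.topNat = 1 := by
  rw [antipodeCoeff, mul_comm]
  exact H.prod_eq

theorem act_eq_top_iff (v : Fin n → ℕ) : act π v = P.topNat ↔ v = P.topNat := by
  refine ⟨fun h => ?_, fun h => by rw [h, H.compatible.act_top]⟩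
  rw [← act_act H.sq_eq_one v, h, H.compatible.act_top]

/-- The indices `v = a - 1` and `v = 0` give the two primitive terms; the first has coefficient 1
precisely by the condition `q_π ∏ c_i^{a_i-1} = 1`. -/
theorem comulMap_topMon_eq : P.comulMap π c P.topMon = 1 ⊗ₜ P.topMon + P.topMon ⊗ₜ 1 +
    ∑ v ∈ (Finset.univ.erase P.topV).erase P.zeroV,
      P.g π c v • (P.mon (P.topNat - P.toNat v) ⊗ₜ[K] P.mon (act π (P.toNat v))) := by
  rw [comulMap_topMon, ← Finset.add_sum_erase _ _ (Finset.mem_univ P.topV),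
    ← Finset.add_sum_erase _ _ (Finset.mem_erase.2 ⟨P.topV_ne_zeroV.symm, Finset.mem_univ P.zeroV⟩),
    ← add_assoc]
  simp only [g_eq, toNat_topV, toNat_zeroV, tsub_self, tsub_zero, qMul_zero_left, qMul_zero_right,
    H.antipodeCoeff_top, H.compatible.act_top, act_zero, mon_zero, antipodeCoeff_zero, inv_one, one_mul,
    one_smul]
  rfl

omit H in
theorem comulMap_left (v : P.V) (hv : v ∈ (Finset.univ.erase P.topV).erase P.zeroV) :
    P.comulMap π c (P.mon (P.topNat - P.toNat v)) =
      1 ⊗ₜ P.mon (P.topNat - P.toNat v) + P.mon (P.topNat - P.toNat v) ⊗ₜ 1 := by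
  simp only [Finset.mem_erase, Finset.mem_univ, and_true] at hv
  refine P.comulMap_mon π c _ (P.toNat_lt (P.complV v)) ?_ ?_
  · rw [Ne, top_sub_eq_zero_iff]
    exact hv.2
  · rw [Ne, top_sub_eq_top_iff]
    exact hv.1

theorem comulMap_right (v : P.V) (hv : v ∈ (Finset.univ.erase P.topV).erase P.zeroV) :
    P.comulMap π c (P.mon (act π (P.toNat v))) =
      1 ⊗ₜ P.mon (act π (P.toNat v)) + P.mon (act π (P.toNat v)) ⊗ₜ 1 := by
  simp only [Finset.mem_erase, Finset.mem_univ, and_true] at hv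
  refine P.comulMap_mon π c _ ((H.compatible.act_lt _).2 (P.toNat_lt v)) ?_ ?_
  · rw [Ne, act_eq_zero_iff, toNat_eq_zero_iff]
    exact hv.1
  · rw [Ne, H.act_eq_top_iff, toNat_eq_top_iff]
    exact hv.2

omit H in
theorem linearMap_ext {M : Type*} [AddCommMonoid M] [Module K M] {F G : P.Alg →ₗ[K] M}
    (h1 : F 1 = G 1) (ht : F P.topMon = G P.topMon)
    (h : ∀ v : Fin n → ℕ, (∀ i, v i < P.a i) → v ≠ 0 → v ≠ P.topNat → F (P.mon v) = G (P.mon v)) :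
    F = G := by
  refine P.stdBasis.ext fun v => ?_
  rw [stdBasis_apply]
  by_cases h0 : P.toNat v = 0
  · rw [h0, mon_zero, h1]
  by_cases h2 : P.toNat v = P.topNat
  · rw [h2, ← topMon_eq, ht]
  exact h _ (P.toNat_lt v) h0 h2

/-- Holds summand by summand: for `l ⊗ r` with `Δ(y) = 1 ⊗ y + y ⊗ 1` for both factors, each side is
`1 ⊗ l ⊗ r + l ⊗ 1 ⊗ r + l ⊗ r ⊗ 1`. -/
theorem coassoc_middle :
    TensorProduct.assoc K P.Alg P.Alg P.Alg ((P.comulMap π c).rTensor P.Alg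
      (∑ v ∈ (Finset.univ.erase P.topV).erase P.zeroV,
        P.g π c v • (P.mon (P.topNat - P.toNat v) ⊗ₜ[K] P.mon (act π (P.toNat v))))) +
    TensorProduct.assoc K P.Alg P.Alg P.Alg
      ((∑ v ∈ (Finset.univ.erase P.topV).erase P.zeroV,
        P.g π c v • (P.mon (P.topNat - P.toNat v) ⊗ₜ[K] P.mon (act π (P.toNat v)))) ⊗ₜ 1) =
    (P.comulMap π c).lTensor P.Alg (∑ v ∈ (Finset.univ.erase P.topV).erase P.zeroV,
        P.g π c v • (P.mon (P.topNat - P.toNat v) ⊗ₜ[K] P.mon (act π (P.toNat v)))) +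
    1 ⊗ₜ (∑ v ∈ (Finset.univ.erase P.topV).erase P.zeroV,
        P.g π c v • (P.mon (P.topNat - P.toNat v) ⊗ₜ[K] P.mon (act π (P.toNat v)))) := by
  simp only [TensorProduct.sum_tmul, TensorProduct.tmul_sum, map_sum, ← Finset.sum_add_distrib]
  refine Finset.sum_congr rfl fun v hv => ?_
  rw [TensorProduct.tmul_smul, ← TensorProduct.smul_tmul', map_smul, map_smul, map_smul, map_smul,
    ← smul_add, ← smul_add, LinearMap.rTensor_tmul, LinearMap.lTensor_tmul, comulMap_left v hv,
    H.comulMap_right v hv]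
  simp only [TensorProduct.add_tmul, TensorProduct.tmul_add, map_add, TensorProduct.assoc_tmul]
  congr 1
  abel

/-- The coalgebra structure on `A(q, a)` given by `π` and `c`. -/
noncomputable abbrev coalgebra : Coalgebra K P.Alg where
  comul := P.comulMap π c
  counit := P.counitMap
  coassoc := by
    refine linearMap_ext ?_ ?_ ?_
    · simp [comulMap_one]
    · have h := H.comulMap_topMon_eq
      have h2 := H.coassoc_middle
      set R := ∑ v ∈ (Finset.univ.erase P.topV).erase P.zeroV,
        P.g π c v • (P.mon (P.topNat - P.toNat v) ⊗ₜ[K] P.mon (act π (P.toNat v)))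
      simp only [LinearMap.comp_apply, h, map_add, LinearMap.rTensor_tmul, LinearMap.lTensor_tmul,
        comulMap_one, LinearEquiv.coe_coe, TensorProduct.add_tmul, TensorProduct.tmul_add,
        TensorProduct.assoc_tmul]
      -- Apart from the middle sum, both sides contain the same three tensors of `x_{a-1}` with two
      -- units.
      refine Eq.trans ?_ ((congrArg (fun z => 1 ⊗ₜ[K] (1 ⊗ₜ[K] P.topMon) +
        1 ⊗ₜ[K] (P.topMon ⊗ₜ[K] 1) + P.topMon ⊗ₜ[K] (1 ⊗ₜ[K] 1) + z) h2).trans ?_)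
      · abel
      · abel
    · intro v hv h0 h1
      simp only [LinearMap.comp_apply, P.comulMap_mon π c v hv h0 h1, map_add,
        LinearMap.rTensor_tmul, LinearMap.lTensor_tmul, comulMap_one, LinearEquiv.coe_coe,
        TensorProduct.add_tmul, TensorProduct.tmul_add, TensorProduct.assoc_tmul]
      abel
  rTensor_counit_comp_comul := by
    refine linearMap_ext ?_ ?_ ?_
    · simp [comulMap_one, counitMap_one]
    · simp only [LinearMap.comp_apply, H.comulMap_topMon_eq, map_add, map_sum, map_smul,
        LinearMap.rTensor_tmul, counitMap_one, counitMap_topMon, counitMap_mon,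
        TensorProduct.zero_tmul, TensorProduct.mk_apply, add_zero]
      rw [Finset.sum_eq_zero, add_zero]
      intro v hv
      simp only [Finset.mem_erase, Finset.mem_univ, and_true] at hv
      rw [if_neg, TensorProduct.zero_tmul, smul_zero]
      rw [top_sub_eq_zero_iff]
      exact hv.2
    · intro v hv h0 h1
      simp [P.comulMap_mon π c v hv h0 h1, counitMap_one, counitMap_mon, h0]
  lTensor_counit_comp_comul := by
    refine linearMap_ext ?_ ?_ ?_
    · simp [comulMap_one, counitMap_one]
    · simp only [LinearMap.comp_apply, H.comulMap_topMon_eq, map_add, map_sum, map_smul,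
        LinearMap.lTensor_tmul, counitMap_one, counitMap_topMon, counitMap_mon,
        TensorProduct.tmul_zero, TensorProduct.mk_apply, LinearMap.flip_apply, zero_add]
      rw [Finset.sum_eq_zero, add_zero]
      intro v hv
      simp only [Finset.mem_erase, Finset.mem_univ, and_true] at hv
      rw [if_neg, TensorProduct.tmul_zero, smul_zero]
      rw [act_eq_zero_iff, toNat_eq_zero_iff]
      exact hv.1
    · intro v hv h0 h1
      simp [P.comulMap_mon π c v hv h0 h1, counitMap_one, counitMap_mon, h0]

/-! ### The bi-Frobenius structure -/

omit H in
theorem topDual_mon_mul (u v : Fin n → ℕ) :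
    P.topDual (P.mon u * P.mon v) = if u + v = P.topNat then P.qMul u v else 0 := by
  rw [mon_mul_mon, map_smul, topDual, coord_mon, toNat_topV]
  simp

omit H in
theorem frobeniusAlgebraPair : IsFrobeniusAlgebraPair K P.topDual := by
  intro f
  -- The monomials `x_{a-1-v}` are, up to the scalars divided out here, dual to the `x_v` under `(y,
  -- z) ↦ φ(y z)`.
  refine ⟨∑ v : P.V, (f (P.mon (P.toNat v)) / P.qMul (P.toNat v) (P.topNat - P.toNat v)) •
    P.mon (P.topNat - P.toNat v), fun y => ?_⟩
  suffices h : f = P.topDual ∘ₗ LinearMap.mulRight K (∑ v : P.V,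
      (f (P.mon (P.toNat v)) / P.qMul (P.toNat v) (P.topNat - P.toNat v)) •
        P.mon (P.topNat - P.toNat v)) from LinearMap.congr_fun h y
  refine P.stdBasis.ext fun u => ?_
  simp only [LinearMap.comp_apply, LinearMap.mulRight_apply, stdBasis_apply, Finset.mul_sum,
    mul_smul_comm, map_sum, map_smul, topDual_mon_mul, smul_eq_mul]
  rw [Finset.sum_eq_single u]
  · rw [if_pos (add_tsub_cancel_of_le (P.toNat_le u)), div_mul_cancel₀ _ (P.qMul_ne _ _)]
  · intro v _ hv
    rw [if_neg, mul_zero]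
    intro h
    conv_rhs at h => rw [← add_tsub_cancel_of_le (P.toNat_le v)]
    exact hv (P.toNat_injective (add_right_cancel h)).symm
  · simp

theorem antipodeMap_surjective : Function.Surjective (P.antipodeMap π c) := by
  rw [← LinearMap.range_eq_top, eq_top_iff, ← P.stdBasis.span_eq, Submodule.span_le]
  rintro _ ⟨v, rfl⟩
  refine ⟨(P.antipodeCoeff π c (act π (P.toNat v)))⁻¹ • P.mon (act π (P.toNat v)), ?_⟩
  rw [map_smul, H.compatible.antipodeMap_mon, smul_smul,
    inv_mul_cancel₀ (P.antipodeCoeff_ne π H.ne_zero _), one_smul, act_act H.sq_eq_one,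
    stdBasis_apply]

theorem antipodeMap_topMon : P.antipodeMap π c P.topMon = P.topMon := by
  rw [topMon_eq, H.compatible.antipodeMap_mon, H.compatible.act_top, H.antipodeCoeff_top, one_smul]

/-- On `x_v` only the summand of `Δ(x_{a-1})` with index `v` survives, and the denominator of `g`
cancels `φ(x_{a-1-v} x_v)`. -/
theorem antipodeMap_eq (y : P.Alg) :
    letI := H.coalgebra
    P.antipodeMap π c y = coalgRightAct K P.topMon (P.topDual ∘ₗ LinearMap.mulRight K y) := by
  let := H.coalgebra
  suffices h : P.antipodeMap π c =
      coalgRightActHom P.topMon ∘ₗ (LinearMap.mul K P.Alg).flip.compr₂ P.topDual from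
    LinearMap.congr_fun h y
  refine P.stdBasis.ext fun v => ?_
  change _ = coalgRightAct K P.topMon (P.topDual ∘ₗ LinearMap.mulRight K (P.stdBasis v))
  have hΔ : ∑ w : P.V, (P.g π c w • P.mon (P.topNat - P.toNat w)) ⊗ₜ[K]
      P.mon (act π (P.toNat w)) = P.comulMap π c P.topMon := by
    simp only [comulMap_topMon, TensorProduct.smul_tmul']
  rw [coalgRightAct_eq_sum Finset.univ _ _ hΔ]
  simp only [LinearMap.comp_apply, LinearMap.mulRight_apply, stdBasis_apply, map_smul, 
    topDual_mon_mul, smul_eq_mul]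
  rw [Finset.sum_eq_single v]
  · rw [if_pos (tsub_add_cancel_of_le (P.toNat_le v)), H.compatible.antipodeMap_mon, g_eq,
      mul_right_comm, inv_mul_cancel₀ (P.qMul_ne _ _), one_mul]
  · intro w _ hw
    rw [if_neg, mul_zero, zero_smul]
    intro h
    conv_rhs at h => rw [← tsub_add_cancel_of_le (P.toNat_le w)]
    exact hw (P.toNat_injective (add_left_cancel h)).symm
  · simp

/-- The coefficient identity behind `Δ(S(x_{a-1})) = ∑ S(t₂) ⊗ S(t₁)` for `t = x_{a-1}`; it is
`antipodeCoeff_mul_act` at the exponent `a - 1 - v`. -/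
theorem g_complV (v : P.V) :
    P.g π c (P.complV v) * (P.antipodeCoeff π c (act π (P.topNat - P.toNat v)) *
      P.antipodeCoeff π c (P.toNat v)) = P.g π c v := by
  have h1 := H.antipodeCoeff_mul_act (P.topNat - P.toNat v)
  have h2 := P.qMul_add_left (P.toNat v) (P.topNat - P.toNat v) (P.topNat - P.toNat v)
  have h3 := P.qMul_add_right (P.topNat - P.toNat v) (P.toNat v) (P.topNat - P.toNat v)
  rw [add_tsub_cancel_of_le (P.toNat_le v)] at h2 h3
  rw [h2, h3, mul_div_mul_right _ _ (P.qMul_ne _ _)] at h1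
  rw [g_eq, g_eq, toNat_complV, top_sub_sub]
  calc _ = (P.qMul (P.toNat v) (P.topNat - P.toNat v))⁻¹ *
        (P.antipodeCoeff π c (P.topNat - P.toNat v) *
          P.antipodeCoeff π c (act π (P.topNat - P.toNat v))) *
        P.antipodeCoeff π c (P.toNat v) := by ring
    _ = _ := by
      rw [h1, ← mul_div_assoc, inv_mul_cancel₀ (P.qMul_ne _ _), one_div]

theorem comulMap_antipodeMap (y : P.Alg) :
    P.comulMap π c (P.antipodeMap π c y) = TensorProduct.comm K P.Alg P.Alg
      (TensorProduct.map (P.antipodeMap π c) (P.antipodeMap π c) (P.comulMap π c y)) := by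
  suffices h : P.comulMap π c ∘ₗ P.antipodeMap π c =
      (TensorProduct.comm K P.Alg P.Alg).toLinearMap ∘ₗ
        TensorProduct.map (P.antipodeMap π c) (P.antipodeMap π c) ∘ₗ P.comulMap π c from
    LinearMap.congr_fun h y
  refine linearMap_ext ?_ ?_ ?_
  · simp [comulMap_one, antipodeMap_one]
  · simp only [LinearMap.comp_apply, H.antipodeMap_topMon, comulMap_topMon, map_sum, map_smul,
      TensorProduct.map_tmul, LinearEquiv.coe_coe, TensorProduct.comm_tmul,
      H.compatible.antipodeMap_mon, act_act H.sq_eq_one]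
    -- Swapping tensor factors and applying `S` to both sends the summand indexed by `a - 1 - v` to
    -- the one indexed by `v`.
    refine Fintype.sum_equiv P.complV_involutive.toPerm _ _ fun v => ?_
    simp only [Function.Involutive.coe_toPerm, toNat_complV, top_sub_sub]
    rw [← TensorProduct.smul_tmul', TensorProduct.tmul_smul, smul_smul, smul_smul]
    congr 1
    rw [← H.g_complV v]
    ring
  · intro v hv h0 h1
    have h2 := P.comulMap_mon π c (act π v) ((H.compatible.act_lt v).2 hv)
      (by rwa [Ne, act_eq_zero_iff]) (by rwa [Ne, H.act_eq_top_iff])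
    simp only [LinearMap.comp_apply, P.comulMap_mon π c v hv h0 h1, map_add, map_smul, h2,
      TensorProduct.map_tmul, LinearEquiv.coe_coe, TensorProduct.comm_tmul, antipodeMap_one,
      H.compatible.antipodeMap_mon, TensorProduct.smul_tmul', TensorProduct.tmul_smul, smul_add]
    rw [add_comm]

theorem isBiFrobenius :
    letI := H.coalgebra
    IsBiFrobenius K P.topDual P.topMon (P.antipodeMap π c) := by
  let := H.coalgebra
  exact
    { finite := Module.Finite.of_basis P.stdBasis
      antipode_eq := H.antipodeMap_eq
      counit_one := P.counitMap_one
      counit_mul := P.counitMap_mul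
      comul_one := P.comulMap_one π c
      frobenius_algebra := frobeniusAlgebraPair
      -- Every value of `S` has the form `t ↼ f`, so surjectivity of `S` suffices.
      frobenius_coalgebra := fun y => by
        obtain ⟨z, rfl⟩ := H.antipodeMap_surjective y
        exact ⟨_, (H.antipodeMap_eq z).symm⟩
      antipode_one := P.antipodeMap_one π c
      antipode_mul := H.compatible.antipodeMap_mul c
      counit_antipode := fun y => by
        change P.counitMap (P.antipodeMap π c y) = P.counitMap y
        suffices h : P.counitMap ∘ₗ P.antipodeMap π c = P.counitMap from LinearMap.congr_fun h y
        refine P.stdBasis.ext fun v => ?_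
        rw [LinearMap.comp_apply, stdBasis_apply, H.compatible.antipodeMap_mon, map_smul,
          counitMap_mon, counitMap_mon]
        simp only [act_eq_zero_iff]
        split_ifs with h
        · rw [h, antipodeCoeff_zero, one_smul]
        · rw [smul_zero]
      comul_antipode := H.comulMap_antipodeMap }

theorem isPermutationMap : P.IsPermutationMap (P.antipodeMap π c) := by
  let f : P.V → P.V := fun v =>
    P.ofNat (act π (P.toNat v)) ((H.compatible.act_lt _).2 (P.toNat_lt v))
  have hf : Function.Involutive f := fun v => P.toNat_injective (act_act H.sq_eq_one (P.toNat v))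
  exact ⟨hf.toPerm, fun v => P.antipodeCoeff π c (P.toNat v),
    fun v => H.compatible.antipodeMap_mon c (P.toNat v)⟩

end Admissible

end QCIParam

theorem theorem6p1 {K : Type*} [Field K] {n : ℕ} (P : QCIParam K n) :
    (P.AdmitsPermutationBiFrobenius ↔
      ∃ (π : Equiv.Perm (Fin n)) (c : Fin n → K), P.Admissible π c) ∧
    ∀ (π : Equiv.Perm (Fin n)) (c : Fin n → K), P.Admissible π c →
      (∃ C : Coalgebra K P.Alg,
        C.counit = P.counitMap ∧ C.comul = P.comulMap π c ∧
        IsBiFrobenius K P.topDual P.topMon (P.antipodeMap π c)) ∧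
      ∀ i : Fin n, P.antipodeMap π c (P.x i) = c i • P.x (π i) := by
  refine ⟨⟨fun H => H.exists_admissible, fun ⟨π, c, H⟩ => ?_⟩, fun π c H => ⟨?_, ?_⟩⟩
  · exact ⟨H.coalgebra, _, _, _, H.isBiFrobenius, H.isPermutationMap⟩
  · exact ⟨H.coalgebra, rfl, rfl, H.isBiFrobenius⟩
  · exact H.compatible.antipodeMap_x c
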